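/- A \emph{linear system} $(P,\mathcal L)$ consists of a finite set $P$ of points and a family $\mathcal L$ of subsets of $P$ (lines) such that $|l\cap l'|\le 1$ for all distinct $l,l'\in\mathcal L$; it is \emph{intersecting} if $|l\cap l'|=1$ for all distinct $l,l'\in\mathcal L$. Its transversal number $\tau$ is the least size of a set $T\subseteq P$ meeting every line; its 2-packing number $\nu_2$ is the largest size of a set $R\subseteq\mathcal L$ such that no three distinct lines of $R$ have a common point; and $\Delta$ is the maximum number of lines through a point of $P$. For an integer $r\ge 2$, an \emph{$r$-segment system} is a linear system $(P,\mathcal L)$ with $P\subseteq\mathbb Z^2$ such that every $l\in\mathcal L$ consists of $r$ consecutive integer points on some straight line of $\mathbb R^2$, and every straight line of $\mathbb R^2$ contains at most one $l\in\mathcal L$. Let $(P,\mathcal L)$ be an intersecting $r$-segment system with $r=\nu_2\ge 3$. If $\Delta\ge\lfloor \nu_2/2\rfloor+2$, then $\tau=\lceil \nu_2/2\rceil$. In particular, $(P,\mathcal L)$ satisfies the inequality $\tau\le\lceil r/2\rceil$, which Oliveros, O'Neill and Zerbib conjectured for all intersecting $r$-segment systems with $r\ge 5$. -/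

import Mathlib

/-- A (finite) linear system: a family `lines` of subsets of a finite ground set `points` such that
any two distinct lines share at most one point. -/
structure LinearSystem (α : Type*) [DecidableEq α] where
  points : Finset α
  lines : Finset (Finset α)
  lines_subset : ∀ l ∈ lines, l ⊆ points
  card_inter_le_one : ∀ l ∈ lines, ∀ l' ∈ lines, l ≠ l' → (l ∩ l').card ≤ 1

namespace LinearSystem

variable {α : Type*} [DecidableEq α]

/-- Any two distinct lines meet in exactly one point. -/
def IsIntersecting (S : LinearSystem α) : Prop :=
  ∀ l ∈ S.lines, ∀ l' ∈ S.lines, l ≠ l' → (l ∩ l').card = 1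

/-- A transversal: a set of points meeting every line. -/
def IsTransversal (S : LinearSystem α) (T : Finset α) : Prop :=
  T ⊆ S.points ∧ ∀ l ∈ S.lines, (T ∩ l).Nonempty

/-- The transversal number `τ`: the smallest cardinality of a transversal. -/
noncomputable def transversalNumber (S : LinearSystem α) : ℕ :=
  sInf {k | ∃ T : Finset α, S.IsTransversal T ∧ T.card = k}

/-- A 2-packing: a set of lines no three distinct members of which have a common point. -/
def IsTwoPacking (S : LinearSystem α) (R : Finset (Finset α)) : Prop :=
  R ⊆ S.lines ∧ ∀ a ∈ R, ∀ b ∈ R, ∀ c ∈ R, a ≠ b → a ≠ c → b ≠ c →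
    ¬ ∃ x, x ∈ a ∧ x ∈ b ∧ x ∈ c

/-- The 2-packing number `ν₂`: the largest cardinality of a 2-packing. -/
noncomputable def twoPackingNumber (S : LinearSystem α) : ℕ :=
  sSup {k | ∃ R : Finset (Finset α), S.IsTwoPacking R ∧ R.card = k}

/-- The degree of a point: the number of lines containing it. -/
def degree (S : LinearSystem α) (x : α) : ℕ :=
  (S.lines.filter (fun l => x ∈ l)).card

/-- The maximum degree `Δ`. -/
def maxDegree (S : LinearSystem α) : ℕ :=
  S.points.sup S.degree

/-- `twoPackingNumber` is a genuine maximum. -/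
theorem isGreatest_twoPackingNumber (S : LinearSystem α) :
    IsGreatest {k | ∃ R : Finset (Finset α), S.IsTwoPacking R ∧ R.card = k}
      S.twoPackingNumber := by
  have hne : {k | ∃ R : Finset (Finset α), S.IsTwoPacking R ∧ R.card = k}.Nonempty :=
    ⟨0, ∅, ⟨Finset.empty_subset _, by simp⟩, rfl⟩
  have hbd : BddAbove {k | ∃ R : Finset (Finset α), S.IsTwoPacking R ∧ R.card = k} := by
    refine ⟨S.lines.card, ?_⟩
    rintro k ⟨R, hR, rfl⟩
    exact Finset.card_le_card hR.1
  exact ⟨Nat.sSup_mem hne hbd, fun k hk => le_csSup hbd hk⟩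

/-- `transversalNumber` is a genuine minimum as soon as all lines are nonempty. -/
theorem isLeast_transversalNumber (S : LinearSystem α) (h : ∀ l ∈ S.lines, l.Nonempty) :
    IsLeast {k | ∃ T : Finset α, S.IsTransversal T ∧ T.card = k} S.transversalNumber := by
  have hne : {k | ∃ T : Finset α, S.IsTransversal T ∧ T.card = k}.Nonempty := by
    refine ⟨S.points.card, S.points, ⟨Finset.Subset.refl _, fun l hl => ?_⟩, rfl⟩
    rw [Finset.inter_eq_right.2 (S.lines_subset l hl)]
    exact h l hl
  exact ⟨Nat.sInf_mem hne, fun k hk => Nat.sInf_le hk⟩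

end LinearSystem

/-- `s` consists of `r` consecutive integer points on some line of the plane: the integer points
of such a line, in order, are `a + i • v` with `i : ℤ`, where `a` is one of them and the direction
vector `v` is primitive (its coordinates are coprime). -/
def IsConsecutiveOnLine (r : ℕ) (s : Finset (ℤ × ℤ)) : Prop :=
  ∃ a v : ℤ × ℤ, IsCoprime v.1 v.2 ∧
    s = (Finset.range r).image (fun i : ℕ => a + (i : ℤ) • v)

/-- The inclusion of the integer points in the real plane. -/
def toRealPlane (x : ℤ × ℤ) : ℝ × ℝ := ((x.1 : ℝ), (x.2 : ℝ))

/-- An `r`-segment system: `r ≥ 2`, every line of the system consists of `r` consecutive integer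
points on some line of the plane, and every line of the real plane (a one-dimensional affine
subspace) contains at most one line of the system. -/
structure LinearSystem.IsSegmentSystem (S : LinearSystem (ℤ × ℤ)) (r : ℕ) : Prop where
  two_le : 2 ≤ r
  consecutive : ∀ l ∈ S.lines, IsConsecutiveOnLine r l
  unique_on_line : ∀ M : AffineSubspace ℝ (ℝ × ℝ), Module.finrank ℝ M.direction = 1 →
    ∀ l ∈ S.lines, ∀ l' ∈ S.lines,
      (∀ x ∈ l, toRealPlane x ∈ M) → (∀ x ∈ l', toRealPlane x ∈ M) → l = l'

/-! A point lies on at most two lines of a 2-packing, so `τ ≥ ⌈ν₂/2⌉` (`IsTwoPacking.card_le`). For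
the converse take a point `p` of maximum degree. If at most `2⌊(r-1)/2⌋` lines miss `p`, they can be
pierced two at a time at pairwise intersections, and with `p` this gives `⌊(r-1)/2⌋ + 1 = ⌈r/2⌉`
points. The heart is that count, `card_le_of_meetsPencil`.

Fix `⌊r/2⌋ + 2` lines through `p`, the pencil. Two lines missing `p` are related by projection from
`p`, so the positions `(x, y)` in which they meet the pencil lie on a hyperbola with axis-parallel
asymptotes, inside a lattice square of side `r - 1`. The pencil cuts the circle of directions into
as many arcs as it has lines, so among more lines than that, two have directions in one arc
(`exists_not_separated`). Their positions lie on one branch, a strictly convex chain up to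
reflection. Its steps have distinct slopes, so the chain is too long for the square
(`hyperbola_branch_sorted`) unless `r = 5` and the hyperbola is `(x + 2)(y + 2) = 12`. This
exceptional pair leaves no room for a third line (`ExceptionalPair.eq_or_eq_of_three`).

The pigeonhole lacks lines exactly for `r = 3, 4, 6`. There no two lines missing `p` coexist at all,
by divisibility of positions or preservation of cross-ratios. -/

/-! ### Lattice points on one branch of a hyperbola -/

/-- Fractions `b i / a i` that strictly decrease are represented by distinct pairs of positive
integers, so few of them have a small sum `a i + b i`. -/
theorem five_mul_le_sum_of_slopes_decreasing {m : ℕ} {a b : ℕ → ℕ}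
    (ha : ∀ i < m, 0 < a i) (hb : ∀ i < m, 0 < b i)
    (hslope : ∀ j < m, ∀ i < j, b j * a i < b i * a j) :
    5 * m ≤ ∑ i ∈ Finset.range m, (a i + b i) + 9 := by
  classical
  -- Truncated subtraction: only pairs of sum at most 4 have a positive deficit.
  set w : ℕ × ℕ → ℕ := fun p => 5 - (p.1 + p.2) with hw
  have hne : ∀ i < m, ∀ j < m, i ≠ j → b j * a i ≠ b i * a j := by
    intro i hi j hj hij
    rcases lt_or_gt_of_ne hij with h | h
    · exact (hslope j hj i h).ne
    · exact (hslope i hi j h).ne'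
  have hinj : Set.InjOn (fun i => (a i, b i)) (Finset.range m : Set ℕ) := by
    intro i hi j hj hij
    by_contra hne'
    simp only [Prod.mk.injEq] at hij
    refine hne i (by simpa using hi) j (by simpa using hj) hne' ?_
    rw [hij.1, hij.2]
  set J := (Finset.range m).image (fun i => (a i, b i)) with hJ
  have hpos : ∀ p ∈ J, 0 < p.1 ∧ 0 < p.2 := by
    intro p hp
    simp only [hJ, Finset.mem_image, Finset.mem_range] at hp
    obtain ⟨i, hi, rfl⟩ := hp
    exact ⟨ha i hi, hb i hi⟩
  have hsum : ∑ i ∈ Finset.range m, w (a i, b i) = ∑ p ∈ J, w p := by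
    rw [hJ, Finset.sum_image hinj]
  set B : Finset (ℕ × ℕ) := Finset.Icc 1 4 ×ˢ Finset.Icc 1 4 with hB
  have hJB : ∑ p ∈ J, w p = ∑ p ∈ J ∩ B, w p := by
    symm
    refine Finset.sum_subset Finset.inter_subset_left fun p hp hpB => ?_
    have h1 := hpos p hp
    have h2 : p ∉ B := fun h => hpB (Finset.mem_inter.2 ⟨hp, h⟩)
    simp only [hB, Finset.mem_product, Finset.mem_Icc] at h2
    simp only [hw]
    omega
  have hle : ∑ p ∈ J ∩ B, w p ≤ 9 := by
    -- The deficits of all positive pairs total 3 + 2·2 + 3·1 = 10, but `(1, 1)` and `(2, 2)` have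
    -- the same slope, so at least one is absent.
    by_cases h22 : (2, 2) ∈ J
    · have h11 : (1, 1) ∉ J := by
        intro h11
        simp only [hJ, Finset.mem_image, Finset.mem_range, Prod.mk.injEq] at h11 h22
        obtain ⟨i, hi, hi1, hi2⟩ := h11
        obtain ⟨j, hj, hj1, hj2⟩ := h22
        refine hne i hi j hj ?_ ?_
        · rintro rfl
          omega
        · rw [hi1, hi2, hj1, hj2]
      calc ∑ p ∈ J ∩ B, w p ≤ ∑ p ∈ B.erase (1, 1), w p := by
            refine Finset.sum_le_sum_of_subset fun p hp => ?_
            rw [Finset.mem_inter] at hp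
            exact Finset.mem_erase.2 ⟨fun h => h11 (h ▸ hp.1), hp.2⟩
        _ ≤ 9 := by rw [hw, hB]; decide
    · calc ∑ p ∈ J ∩ B, w p ≤ ∑ p ∈ B.erase (2, 2), w p := by
            refine Finset.sum_le_sum_of_subset fun p hp => ?_
            rw [Finset.mem_inter] at hp
            exact Finset.mem_erase.2 ⟨fun h => h22 (h ▸ hp.1), hp.2⟩
        _ ≤ 9 := by rw [hw, hB]; decide
  have htot : ∑ i ∈ Finset.range m, 5 ≤
      ∑ i ∈ Finset.range m, (a i + b i + w (a i, b i)) := by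
    refine Finset.sum_le_sum fun i _ => ?_
    simp only [hw]
    omega
  rw [Finset.sum_add_distrib, hsum, hJB] at htot
  simp only [Finset.sum_const, Finset.card_range, smul_eq_mul] at htot
  omega

/-- The chords of a convex decreasing branch of a hyperbola. -/
theorem hyperbola_chord {α γ β K x x' y y' : ℤ} (hα : 0 < α)
    (h : (α * x + γ) * (α * y + β) = K) (h' : (α * x' + γ) * (α * y' + β) = K) :
    (y - y') * ((α * x + γ) * (α * x' + γ)) = K * (x' - x) := by
  have : α * ((y - y') * ((α * x + γ) * (α * x' + γ)) - K * (x' - x)) = 0 := by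
    linear_combination (α * x' + γ) * h - (α * x + γ) * h'
  rcases mul_eq_zero.1 this with h0 | h0
  · omega
  · linarith

/-- Integer points on one branch of a hyperbola, listed by increasing abscissa, inside a square
with `r` integer points on each side: about `r / 2` points are possible only for `r = 5`. -/
theorem hyperbola_branch_sorted {r m : ℕ} (hr : 5 ≤ r) (hr6 : r ≠ 6) (hm : m = r / 2 + 1)
    {f g : ℕ → ℤ} {α γ β K : ℤ} (hα : 0 < α) (hK : 0 < K)
    (hf : ∀ i < m, f i < f (i + 1))
    (hu : ∀ i ≤ m, 0 < α * f i + γ)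
    (h : ∀ i ≤ m, (α * f i + γ) * (α * g i + β) = K)
    (hf0 : ∀ i ≤ m, 0 ≤ f i ∧ f i ≤ r - 1) (hg0 : ∀ i ≤ m, 0 ≤ g i ∧ g i ≤ r - 1) :
    r = 5 ∧ γ = 2 * α ∧ β = 2 * α ∧
      f 0 = 0 ∧ f 1 = 1 ∧ f 2 = 2 ∧ f 3 = 4 ∧ g 0 = 4 ∧ g 1 = 2 ∧ g 2 = 1 ∧ g 3 = 0 := by
  set u : ℕ → ℤ := fun i => α * f i + γ with hudef
  have hchord : ∀ i < m, (g i - g (i + 1)) * (u i * u (i + 1)) = K * (f (i + 1) - f i) :=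
    fun i hi => hyperbola_chord hα (h i hi.le) (h (i + 1) hi)
  have hupos : ∀ i ≤ m, 0 < u i := hu
  have hg : ∀ i < m, g (i + 1) < g i := by
    intro i hi
    have h1 : 0 < K * (f (i + 1) - f i) := mul_pos hK (by linarith [hf i hi])
    rw [← hchord i hi] at h1
    have := (mul_pos_iff_of_pos_right (mul_pos (hupos i hi.le) (hupos (i + 1) hi))).1 h1
    linarith
  have humono : ∀ i < m, u i < u (i + 1) := by
    intro i hi
    have := mul_lt_mul_of_pos_left (hf i hi) hα
    simp only [hudef]
    linarith
  have humono' : ∀ j ≤ m, ∀ i < j, u i < u j := by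
    intro j
    induction j with
    | zero => intro _ i hi; omega
    | succ j ih =>
      intro hj i hi
      rcases Nat.lt_succ_iff_lt_or_eq.1 hi with h1 | rfl
      · exact (ih (by omega) i h1).trans (humono j hj)
      · exact humono _ hj
  -- The chord from `i` to `i + 1` descends with slope `K / (u i * u (i + 1))`, and `u` increases.
  have hslope : ∀ j < m, ∀ i < j,
      (g j - g (j + 1)) * (f (i + 1) - f i) < (g i - g (i + 1)) * (f (j + 1) - f j) := by
    intro j hj i hi
    have hP : 0 < u i * u (i + 1) := mul_pos (hupos i (by omega)) (hupos (i + 1) (by omega))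
    have hPP : u i * u (i + 1) < u j * u (j + 1) :=
      mul_lt_mul'' (humono' j hj.le i hi) (humono' (j + 1) hj (i + 1) (by omega))
        (hupos i (by omega)).le (hupos (i + 1) (by omega)).le
    have e1 := hchord i (by omega)
    have e2 := hchord j hj
    have hb : 0 < g j - g (j + 1) := by linarith [hg j hj]
    have ha : 0 < f (i + 1) - f i := by linarith [hf i (by omega)]
    have hab := mul_pos hb ha
    by_contra hcon
    push Not at hcon
    have h1 := mul_le_mul_of_nonneg_right hcon hP.le
    have h2 := mul_lt_mul_of_pos_left hPP hab
    have h3 : (g i - g (i + 1)) * (f (j + 1) - f j) * (u i * u (i + 1)) =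
        (g j - g (j + 1)) * (f (i + 1) - f i) * (u j * u (j + 1)) := by
      linear_combination (f (j + 1) - f j) * e1 - (f (i + 1) - f i) * e2
    linarith
  have hsumf : ∑ i ∈ Finset.range m, (f (i + 1) - f i) = f m - f 0 := Finset.sum_range_sub f m
  have hsumg : ∑ i ∈ Finset.range m, (g i - g (i + 1)) = g 0 - g m := Finset.sum_range_sub' g m
  -- The steps total at most `2 (r - 1)`, so `5 (r / 2 + 1) ≤ 2 (r - 1) + 9`.
  have hbound : r = 5 ∨ r = 7 ∨ r = 9 := by
    have hcast : ∀ i < m, ((f (i + 1) - f i).toNat : ℤ) = f (i + 1) - f i ∧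
        ((g i - g (i + 1)).toNat : ℤ) = g i - g (i + 1) := fun i hi => by
      have := hf i hi
      have := hg i hi
      omega
    have key := five_mul_le_sum_of_slopes_decreasing (m := m)
      (a := fun i => (f (i + 1) - f i).toNat) (b := fun i => (g i - g (i + 1)).toNat)
      (fun i hi => by have := hf i hi; omega) (fun i hi => by have := hg i hi; omega)
      (fun j hj i hi => by
        have := hslope j hj i hi
        zify
        rw [(hcast i (by omega)).1, (hcast i (by omega)).2, (hcast j hj).1, (hcast j hj).2]
        exact this)
    have hsum : ((∑ i ∈ Finset.range m,
        ((f (i + 1) - f i).toNat + (g i - g (i + 1)).toNat) : ℕ) : ℤ) =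
        (f m - f 0) + (g 0 - g m) := by
      rw [← hsumf, ← hsumg, ← Finset.sum_add_distrib]
      push_cast
      refine Finset.sum_congr rfl fun i hi => ?_
      have := hcast i (Finset.mem_range.1 hi)
      omega
    have := hf0 0 (by omega)
    have := hf0 m le_rfl
    have := hg0 0 (by omega)
    have := hg0 m le_rfl
    omega
  rcases hbound with rfl | rfl | rfl
  · obtain rfl : m = 3 := by omega
    have s0 := hslope 1 (by norm_num) 0 (by norm_num)
    have s1 := hslope 2 (by norm_num) 1 (by norm_num)
    have a0 := hf 0 (by norm_num)
    have a1 := hf 1 (by norm_num)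
    have a2 := hf 2 (by norm_num)
    have b0 := hg 0 (by norm_num)
    have b1 := hg 1 (by norm_num)
    have b2 := hg 2 (by norm_num)
    have c0 := hchord 0 (by norm_num)
    have c1 := hchord 1 (by norm_num)
    have hf00 := hf0 0 (by norm_num)
    have hf3 := hf0 3 (by norm_num)
    have hg00 := hg0 0 (by norm_num)
    have hg3 := hg0 3 (by norm_num)
    have hh := h 0 (by norm_num)
    have hu0 := hu 0 (by norm_num)
    norm_num at *
    obtain ⟨A, hA⟩ : ∃ A, A = f 1 - f 0 := ⟨_, rfl⟩
    obtain ⟨B, hB⟩ : ∃ B, B = f 2 - f 1 := ⟨_, rfl⟩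
    obtain ⟨C, hC⟩ : ∃ C, C = f 3 - f 2 := ⟨_, rfl⟩
    rw [← hA, ← hB] at s0
    rw [← hB, ← hC] at s1
    have hA1 : 1 ≤ A := by omega
    have hA2 : A ≤ 2 := by omega
    have hB1 : 1 ≤ B := by omega
    have hB2 : B ≤ 2 := by omega
    have hC1 : 1 ≤ C := by omega
    have hC2 : C ≤ 2 := by omega
    -- Only the steps (1, 2), (1, 1), (2, 1) fit in a square of side 4.
    have hval : f 0 = 0 ∧ f 1 = 1 ∧ f 2 = 2 ∧ f 3 = 4 ∧ g 0 = 4 ∧ g 1 = 2 ∧ g 2 = 1 ∧ g 3 = 0 := by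
      clear c0 c1 hh
      interval_cases A <;> interval_cases B <;> interval_cases C <;> omega
    obtain ⟨v0, v1, v2, v3, w0, w1, w2, w3⟩ := hval
    simp only [hudef, v0, v1, v2, w0, w1, w2] at c0 c1 hh hu0
    have e1 : (α + γ) * (2 * γ - (2 * α + γ)) = 0 := by linear_combination c0 - c1
    have hγ : γ = 2 * α := by
      rcases mul_eq_zero.1 e1 with e | e
      · linarith
      · linarith
    subst hγ
    have e2 : (2 * α) * (β - 2 * α) = 0 := by linear_combination hh - c1
    have hβ : β = 2 * α := by
      rcases mul_eq_zero.1 e2 with e | e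
      · linarith
      · linarith
    exact ⟨rfl, hβ, v0, v1, v2, v3, w0, w1, w2, w3⟩
  -- For `r = 7`, convexity alone excludes four steps in a square of side 6.
  · exfalso
    obtain rfl : m = 4 := by omega
    have s0 := hslope 1 (by norm_num) 0 (by norm_num)
    have s1 := hslope 2 (by norm_num) 1 (by norm_num)
    have s2 := hslope 3 (by norm_num) 2 (by norm_num)
    have a0 := hf 0 (by norm_num)
    have a1 := hf 1 (by norm_num)
    have a2 := hf 2 (by norm_num)
    have a3 := hf 3 (by norm_num)
    have b0 := hg 0 (by norm_num)
    have b1 := hg 1 (by norm_num)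
    have b2 := hg 2 (by norm_num)
    have b3 := hg 3 (by norm_num)
    have hf00 := hf0 0 (by norm_num)
    have hf4 := hf0 4 (by norm_num)
    have hg00 := hg0 0 (by norm_num)
    have hg4 := hg0 4 (by norm_num)
    clear hchord h hu hupos hg humono humono' hslope hsumf hsumg hf0 hg0 hf
    norm_num at *
    obtain ⟨A, hA⟩ : ∃ A, A = f 1 - f 0 := ⟨_, rfl⟩
    obtain ⟨B, hB⟩ : ∃ B, B = f 2 - f 1 := ⟨_, rfl⟩
    obtain ⟨C, hC⟩ : ∃ C, C = f 3 - f 2 := ⟨_, rfl⟩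
    obtain ⟨D, hD⟩ : ∃ D, D = f 4 - f 3 := ⟨_, rfl⟩
    rw [← hA, ← hB] at s0
    rw [← hB, ← hC] at s1
    rw [← hC, ← hD] at s2
    have hA1 : 1 ≤ A := by omega
    have hB1 : 1 ≤ B := by omega
    have hC1 : 1 ≤ C := by omega
    have hD1 : 1 ≤ D := by omega
    have hA2 : A ≤ 3 := by omega
    have hB2 : B ≤ 4 - A := by omega
    have hC2 : C ≤ 5 - A - B := by omega
    have hD2 : D ≤ 6 - A - B - C := by omega
    interval_cases A <;> interval_cases B <;> interval_cases C <;> interval_cases D <;> omega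
  · exfalso
    obtain rfl : m = 5 := by omega
    have s0 := hslope 1 (by norm_num) 0 (by norm_num)
    have s1 := hslope 2 (by norm_num) 1 (by norm_num)
    have s2 := hslope 3 (by norm_num) 2 (by norm_num)
    have s3 := hslope 4 (by norm_num) 3 (by norm_num)
    have a0 := hf 0 (by norm_num)
    have a1 := hf 1 (by norm_num)
    have a2 := hf 2 (by norm_num)
    have a3 := hf 3 (by norm_num)
    have a4 := hf 4 (by norm_num)
    have b0 := hg 0 (by norm_num)
    have b1 := hg 1 (by norm_num)
    have b2 := hg 2 (by norm_num)
    have b3 := hg 3 (by norm_num)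
    have b4 := hg 4 (by norm_num)
    have c0 := hchord 0 (by norm_num)
    have c1 := hchord 1 (by norm_num)
    have c2 := hchord 2 (by norm_num)
    have hf00 := hf0 0 (by norm_num)
    have hf5 := hf0 5 (by norm_num)
    have hg00 := hg0 0 (by norm_num)
    have hg5 := hg0 5 (by norm_num)
    have hu0 := hu 0 (by norm_num)
    clear hchord h hu hupos hg humono humono' hslope hsumf hsumg hf0 hg0 hf
    norm_num at *
    obtain ⟨A, hA⟩ : ∃ A, A = f 1 - f 0 := ⟨_, rfl⟩
    obtain ⟨B, hB⟩ : ∃ B, B = f 2 - f 1 := ⟨_, rfl⟩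
    obtain ⟨C, hC⟩ : ∃ C, C = f 3 - f 2 := ⟨_, rfl⟩
    obtain ⟨D, hD⟩ : ∃ D, D = f 4 - f 3 := ⟨_, rfl⟩
    obtain ⟨E, hE⟩ : ∃ E, E = f 5 - f 4 := ⟨_, rfl⟩
    rw [← hA, ← hB] at s0
    rw [← hB, ← hC] at s1
    rw [← hC, ← hD] at s2
    rw [← hD, ← hE] at s3
    -- For `r = 9` the counting bound is attained and a chain exists, but it lies on no hyperbola:
    -- the first three chords give `3 u₀ u₁ = 2 u₁ u₂ = u₂ u₃`, so `γ = 4α` and then `60 α² = 42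
    -- α²`.
    have hval : f 0 = 0 ∧ f 1 = 1 ∧ f 2 = 2 ∧ f 3 = 3 ∧ g 0 = 8 ∧ g 1 = 5 ∧ g 2 = 3 ∧ g 3 = 2 := by
      clear c0 c1 c2
      have hA1 : 1 ≤ A := by omega
      have hB1 : 1 ≤ B := by omega
      have hC1 : 1 ≤ C := by omega
      have hD1 : 1 ≤ D := by omega
      have hE1 : 1 ≤ E := by omega
      have hA2 : A ≤ 4 := by omega
      have hB2 : B ≤ 5 - A := by omega
      have hC2 : C ≤ 6 - A - B := by omega
      have hD2 : D ≤ 7 - A - B - C := by omega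
      have hE2 : E ≤ 8 - A - B - C - D := by omega
      interval_cases A <;> interval_cases B <;> interval_cases C <;> interval_cases D <;>
        interval_cases E <;> omega
    obtain ⟨v0, v1, v2, v3, w0, w1, w2, w3⟩ := hval
    simp only [hudef, v0, v1, v2, v3, w0, w1, w2, w3] at c0 c1 c2 hu0
    have e1 : (α + γ) * (3 * γ - 2 * (2 * α + γ)) = 0 := by linear_combination c0 - c1
    have hγ : γ = 4 * α := by
      rcases mul_eq_zero.1 e1 with e | e
      · linarith
      · linarith
    subst hγ
    have e2 : 18 * (α * α) = 0 := by linear_combination c1 - c2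
    have := mul_pos hα hα
    omega

/-- Integer points on one branch of a hyperbola inside a square with `r` integer points on each
side: about `r / 2` points are possible only for `r = 5`, and then in only one way. -/
theorem hyperbola_branch {ι : Type*} {I : Finset ι} {r : ℕ} (hr : 5 ≤ r) (hr6 : r ≠ 6)
    (hI : I.card = r / 2 + 2) {x y : ι → ℤ} {α γ β K : ℤ} (hK : 0 < K)
    (hx : Set.InjOn x I) (hx0 : ∀ i ∈ I, 0 ≤ x i ∧ x i ≤ r - 1)
    (hy0 : ∀ i ∈ I, 0 ≤ y i ∧ y i ≤ r - 1)
    (hu : ∀ i ∈ I, 0 < α * (α * x i + γ))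
    (h : ∀ i ∈ I, (α * x i + γ) * (α * y i + β) = K) :
    r = 5 ∧ γ = 2 * α ∧ β = 2 * α ∧ ∃ i ∈ I, ∃ j ∈ I, ∃ k ∈ I, ∃ l ∈ I,
      (x i = 0 ∧ x j = 1 ∧ x k = 2 ∧ x l = 4) ∧ (y i = 4 ∧ y j = 2 ∧ y k = 1 ∧ y l = 0) := by
  classical
  have hcard : (I.image x).card = r / 2 + 2 := by rw [Finset.card_image_of_injOn hx, hI]
  set e := (I.image x).orderEmbOfFin hcard with he
  have hidx : ∀ n : Fin (r / 2 + 2), ∃ i ∈ I, x i = e n := fun n => by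
    have := Finset.orderEmbOfFin_mem (I.image x) hcard n
    exact Finset.mem_image.1 this
  choose idx hidxI hidxe using hidx
  -- Indices listed by increasing abscissa; the value past the end is never used.
  set J : ℕ → ι := fun n => if hn : n < r / 2 + 2 then idx ⟨n, hn⟩ else idx 0 with hJ
  have hJI : ∀ n, J n ∈ I := fun n => by
    simp only [hJ]
    split_ifs <;> exact hidxI _
  have hmono : ∀ n < r / 2 + 1, x (J n) < x (J (n + 1)) := by
    intro n hn
    have h1 : n < r / 2 + 2 := by omega
    have h2 : n + 1 < r / 2 + 2 := by omega
    simp only [hJ, h1, h2, dif_pos, hidxe]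
    exact e.strictMono (by simp [Fin.lt_def])
  have hα0 : α ≠ 0 := by
    rintro rfl
    simpa using hu _ (hJI 0)
  rcases lt_or_gt_of_ne hα0 with hα | hα
  -- Negating `α`, `γ`, `β` together keeps the hyperbola and makes `α` positive.
  · obtain ⟨h1, h2, h3, h4⟩ := hyperbola_branch_sorted (f := fun n => x (J n))
      (g := fun n => y (J n)) (α := -α) (γ := -γ) (β := -β) (K := K) hr hr6 rfl (by omega) hK hmono
      (fun n _ => by
        have h5 := hu _ (hJI n)
        by_contra hcon
        have h6 : 0 ≤ α * x (J n) + γ := by linarith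
        have := mul_nonpos_of_nonpos_of_nonneg hα.le h6
        omega)
      (fun n _ => by linear_combination h _ (hJI n))
      (fun n _ => hx0 _ (hJI n)) (fun n _ => hy0 _ (hJI n))
    obtain ⟨a0, a1, a2, a3, b0, b1, b2, b3⟩ := h4
    exact ⟨h1, by omega, by omega, J 0, hJI 0, J 1, hJI 1, J 2, hJI 2, J 3, hJI 3,
      ⟨a0, a1, a2, a3⟩, ⟨b0, b1, b2, b3⟩⟩
  · obtain ⟨h1, h2, h3, h4⟩ := hyperbola_branch_sorted (f := fun n => x (J n))
      (g := fun n => y (J n)) (α := α) (γ := γ) (β := β) (K := K) hr hr6 rfl hα hK hmono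
      (fun n _ => (mul_pos_iff_of_pos_left hα).1 (hu _ (hJI n)))
      (fun n _ => h _ (hJI n))
      (fun n _ => hx0 _ (hJI n)) (fun n _ => hy0 _ (hJI n))
    obtain ⟨a0, a1, a2, a3, b0, b1, b2, b3⟩ := h4
    exact ⟨h1, by omega, by omega, J 0, hJI 0, J 1, hJI 1, J 2, hJI 2, J 3, hJI 3,
      ⟨a0, a1, a2, a3⟩, ⟨b0, b1, b2, b3⟩⟩

/-! ### Cross-ratios on a hyperbola, and finite tables -/

/-- Points on a hyperbola with axis-parallel asymptotes have equal cross-ratios of abscissas and of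
ordinates. -/
theorem hyperbola_crossRatio {α γ β K : ℤ} (hα : α ≠ 0) (hK : K ≠ 0) {x y : Fin 4 → ℤ}
    (h : ∀ i, (α * x i + γ) * (α * y i + β) = K) :
    (x 0 - x 1) * (x 2 - x 3) * ((y 0 - y 2) * (y 1 - y 3)) =
      (x 0 - x 2) * (x 1 - x 3) * ((y 0 - y 1) * (y 2 - y 3)) := by
  have hd : ∀ i j, (y i - y j) * ((α * x i + γ) * (α * x j + γ)) = K * (x j - x i) := by
    intro i j
    have : α * ((y i - y j) * ((α * x i + γ) * (α * x j + γ)) - K * (x j - x i)) = 0 := by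
      linear_combination (α * x j + γ) * h i - (α * x i + γ) * h j
    rcases mul_eq_zero.1 this with h0 | h0
    · exact absurd h0 hα
    · linarith
  have hu : ∀ i, α * x i + γ ≠ 0 := fun i h0 => hK (by rw [← h i, h0, zero_mul])
  have hP : (α * x 0 + γ) * (α * x 1 + γ) * ((α * x 2 + γ) * (α * x 3 + γ)) ≠ 0 :=
    mul_ne_zero (mul_ne_zero (hu 0) (hu 1)) (mul_ne_zero (hu 2) (hu 3))
  refine mul_right_cancel₀ hP ?_
  have e02 := hd 0 2
  have e13 := hd 1 3
  have e01 := hd 0 1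
  have e23 := hd 2 3
  generalize (α * x 0 + γ) = u0 at *
  generalize (α * x 1 + γ) = u1 at *
  generalize (α * x 2 + γ) = u2 at *
  generalize (α * x 3 + γ) = u3 at *
  linear_combination (x 0 - x 1) * (x 2 - x 3) * ((y 1 - y 3) * (u1 * u3) * e02 +
    K * (x 2 - x 0) * e13) - (x 0 - x 2) * (x 1 - x 3) * ((y 2 - y 3) * (u2 * u3) * e01 +
    K * (x 1 - x 0) * e23)

/-- Three points on a hyperbola with axis-parallel asymptotes are not collinear. -/
theorem hyperbola_not_collinear {α γ β K : ℤ} (hα : α ≠ 0) (hK : K ≠ 0) {x y : Fin 3 → ℤ}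
    (h01 : x 0 ≠ x 1) (h02 : x 0 ≠ x 2) (h12 : x 1 ≠ x 2)
    (h : ∀ i, (α * x i + γ) * (α * y i + β) = K) :
    (y 0 - y 1) * (x 2 - x 1) ≠ (y 1 - y 2) * (x 1 - x 0) := by
  intro hcon
  have hd : ∀ i j, (y i - y j) * ((α * x i + γ) * (α * x j + γ)) = K * (x j - x i) := by
    intro i j
    have : α * ((y i - y j) * ((α * x i + γ) * (α * x j + γ)) - K * (x j - x i)) = 0 := by
      linear_combination (α * x j + γ) * h i - (α * x i + γ) * h j
    rcases mul_eq_zero.1 this with h0 | h0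
    · exact absurd h0 hα
    · linarith
  have key : (x 1 - x 0) * (x 2 - x 1) * K * (α * (x 2 - x 0)) = 0 := by
    linear_combination (α * x 0 + γ) * (α * x 1 + γ) * (α * x 2 + γ) * hcon -
      (x 2 - x 1) * (α * x 2 + γ) * hd 0 1 + (x 1 - x 0) * (α * x 0 + γ) * hd 1 2
  have n01 : x 1 - x 0 ≠ 0 := sub_ne_zero.2 h01.symm
  have n12 : x 2 - x 1 ≠ 0 := sub_ne_zero.2 h12.symm
  have n02 : x 2 - x 0 ≠ 0 := sub_ne_zero.2 h02.symm
  exact mul_ne_zero (mul_ne_zero (mul_ne_zero n01 n12) hK) (mul_ne_zero hα n02) key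

/-- No injection of five of six consecutive integers into six consecutive integers preserves
cross-ratios without being affine on the first three of them. -/
theorem crossRatio_six_table : ∀ e : Fin 6, ∀ y0 y1 y2 y3 : Fin 6,
    let p : Fin 5 → ℤ := fun i => ((e.succAbove i : Fin 6) : ℕ)
    let v : Fin 6 → ℤ := fun i => (i : ℕ)
    ((v y0 - v y1) * (p 2 - p 1) ≠ (v y1 - v y2) * (p 1 - p 0) ∧
      y0 ≠ y1 ∧ y0 ≠ y2 ∧ y0 ≠ y3 ∧ y1 ≠ y2 ∧ y1 ≠ y3 ∧ y2 ≠ y3 ∧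
      (p 0 - p 1) * (p 2 - p 3) * ((v y0 - v y2) * (v y1 - v y3)) =
        (p 0 - p 2) * (p 1 - p 3) * ((v y0 - v y1) * (v y2 - v y3))) →
    ∀ y4 : Fin 6, y4 ≠ y0 → y4 ≠ y1 → y4 ≠ y2 → y4 ≠ y3 →
      (p 0 - p 1) * (p 2 - p 4) * ((v y0 - v y2) * (v y1 - v y4)) ≠
        (p 0 - p 2) * (p 1 - p 4) * ((v y0 - v y1) * (v y2 - v y4)) := by
  decide +kernel

/-- The non-affine permutations of four consecutive integers that preserve their cross-ratio. -/
theorem crossRatio_four_table : ∀ y0 y1 y2 y3 : Fin 4,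
    let v : Fin 4 → ℤ := fun i => (i : ℕ)
    (v y0 - v y1 ≠ v y1 - v y2 ∧
      y0 ≠ y1 ∧ y0 ≠ y2 ∧ y0 ≠ y3 ∧ y1 ≠ y2 ∧ y1 ≠ y3 ∧ y2 ≠ y3 ∧
      (v y0 - v y2) * (v y1 - v y3) = 4 * ((v y0 - v y1) * (v y2 - v y3))) →
    (v y0 = 2 ∧ v y1 = 3 ∧ v y2 = 0 ∧ v y3 = 1) ∨
      (v y0 = 1 ∧ v y1 = 0 ∧ v y2 = 3 ∧ v y3 = 2) := by
  decide +kernel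

/-! ### Lines meeting a pencil, in coordinates centred at its common point -/

/-- The determinant of two integer vectors. -/
def cross (u v : ℤ × ℤ) : ℤ := u.1 * v.2 - u.2 * v.1

/-- The line of points `Q + x • W`, not through the origin, meets the line spanned by `V i`, for
each `i ∈ I`, in the point `Q + x i • W = c i • V i`. The positions on the first line lie among
`r` consecutive ones, and so do the positions on each of the others, counting the origin. -/
structure MeetsPencil {ι : Type*} (I : Finset ι) (V : ι → ℤ × ℤ) (r : ℕ) (Q W : ℤ × ℤ)
    (x c : ι → ℤ) : Prop where
  primitive : IsCoprime W.1 W.2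
  eq : ∀ i ∈ I, Q + x i • W = c i • V i
  inj : Set.InjOn x I
  pos_mem : ∀ i ∈ I, 0 ≤ x i ∧ x i ≤ r - 1
  ne_zero : ∀ i ∈ I, c i ≠ 0
  le : ∀ i ∈ I, -(r - 1 : ℤ) ≤ c i ∧ c i ≤ r - 1
  cross_ne : cross Q W ≠ 0

/-- Two lines that meet a pencil meet each other in one of their `r` consecutive points, and the
points in which they meet a line of the pencil lie among `r` consecutive ones. -/
structure MeetEachOther {ι : Type*} (I : Finset ι) (r : ℕ) (Q W : ℤ × ℤ) (c : ι → ℤ)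
    (Q' W' : ℤ × ℤ) (c' : ι → ℤ) : Prop where
  cross_ne : cross W W' ≠ 0
  meet : ∃ s t : ℤ, (0 ≤ s ∧ s ≤ r - 1) ∧ (0 ≤ t ∧ t ≤ r - 1) ∧ Q + s • W = Q' + t • W'
  sub_le : ∀ i ∈ I, -(r - 1 : ℤ) ≤ c i - c' i ∧ c i - c' i ≤ r - 1

theorem eq_zero_of_cross_eq_zero {W W' Z : ℤ × ℤ} (hW : cross W W' ≠ 0) (h : cross W Z = 0)
    (h' : cross Z W' = 0) : Z = 0 := by
  simp only [cross] at *
  have h1 : (W.1 * W'.2 - W.2 * W'.1) * Z.1 = 0 := by linear_combination W'.1 * h + W.1 * h'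
  have h2 : (W.1 * W'.2 - W.2 * W'.1) * Z.2 = 0 := by linear_combination W'.2 * h + W.2 * h'
  exact Prod.ext ((mul_eq_zero.1 h1).resolve_left hW) ((mul_eq_zero.1 h2).resolve_left hW)

section Pair

variable {ι : Type*} {I : Finset ι} {V : ι → ℤ × ℤ} {r : ℕ} {Q W Q' W' : ℤ × ℤ} {x c y c' : ι → ℤ}

theorem MeetsPencil.flip (h : MeetsPencil I V r Q W x c) :
    MeetsPencil I V r (Q + (r - 1 : ℤ) • W) (-W) (fun i => r - 1 - x i) c where
  primitive := h.primitive.neg_neg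
  eq i hi := by
    rw [← h.eq i hi]
    module
  inj i hi j hj hij := h.inj hi hj (by simpa using hij)
  pos_mem i hi := by
    have := h.pos_mem i hi
    constructor <;> omega
  ne_zero := h.ne_zero
  le := h.le
  cross_ne := by
    have := h.cross_ne
    simp only [cross, Prod.fst_add, Prod.snd_add, Prod.smul_fst, Prod.smul_snd, Prod.fst_neg,
      Prod.snd_neg, smul_eq_mul] at *
    contrapose! this
    linear_combination -this

theorem MeetEachOther.symm (h : MeetEachOther I r Q W c Q' W' c') :
    MeetEachOther I r Q' W' c' Q W c where
  cross_ne := by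
    have := h.cross_ne
    simp only [cross] at *
    contrapose! this
    linear_combination -this
  meet := by
    obtain ⟨s, t, hs, ht, h⟩ := h.meet
    exact ⟨t, s, ht, hs, h.symm⟩
  sub_le i hi := by
    have := h.sub_le i hi
    constructor <;> omega

theorem MeetEachOther.flip (h : MeetEachOther I r Q W c Q' W' c') :
    MeetEachOther I r (Q + (r - 1 : ℤ) • W) (-W) c Q' W' c' where
  cross_ne := by
    have := h.cross_ne
    simp only [cross, Prod.fst_neg, Prod.snd_neg] at *
    contrapose! this
    linear_combination -this
  meet := by
    obtain ⟨s, t, hs, ht, h⟩ := h.meet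
    refine ⟨r - 1 - s, t, ⟨by omega, by omega⟩, ht, ?_⟩
    rw [← h]
    module
  sub_le := h.sub_le

theorem MeetsPencil.fst_eq (h : MeetsPencil I V r Q W x c) {i : ι} (hi : i ∈ I) :
    Q.1 + x i * W.1 = c i * (V i).1 := by
  simpa using congrArg Prod.fst (h.eq i hi)

theorem MeetsPencil.snd_eq (h : MeetsPencil I V r Q W x c) {i : ι} (hi : i ∈ I) :
    Q.2 + x i * W.2 = c i * (V i).2 := by
  simpa using congrArg Prod.snd (h.eq i hi)

/-- The positions in which two lines meet a pencil are related by a hyperbola. -/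
theorem MeetsPencil.hyperbola (h : MeetsPencil I V r Q W x c) (h' : MeetsPencil I V r Q' W' y c')
    {i : ι} (hi : i ∈ I) :
    (cross W W' * x i + cross Q W') * (cross W W' * y i + cross W Q') =
      -(cross Q W * cross Q' W') := by
  have e1 := h.fst_eq hi
  have e2 := h.snd_eq hi
  have e3 := h'.fst_eq hi
  have e4 := h'.snd_eq hi
  -- Taking determinants of the incidence relations with `W` and `W'` expresses all four quantities
  -- through `c i`, `c' i` and `V i`.
  have f1 : cross W W' * x i + cross Q W' = c i * cross (V i) W' := by
    simp only [cross]; linear_combination W'.2 * e1 - W'.1 * e2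
  have f2 : cross W W' * y i + cross W Q' = c' i * cross W (V i) := by
    simp only [cross]; linear_combination W.1 * e4 - W.2 * e3
  have f3 : cross Q W = c i * cross (V i) W := by
    simp only [cross]; linear_combination W.2 * e1 - W.1 * e2
  have f4 : cross Q' W' = c' i * cross (V i) W' := by
    simp only [cross]; linear_combination W'.2 * e3 - W'.1 * e4
  rw [f1, f2, f3, f4]
  simp only [cross]
  ring

/-- The ratio `c i / c' i` is thus an affine function of the position `x i`. By `cross_eq_of_meet`
it is normalized to 1 where the two lines meet. -/
theorem MeetsPencil.mul_eq (h : MeetsPencil I V r Q W x c) (h' : MeetsPencil I V r Q' W' y c')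
    {i : ι} (hi : i ∈ I) :
    c' i * (cross W W' * x i + cross Q W') = c i * cross Q' W' := by
  have e1 := h.fst_eq hi
  have e2 := h.snd_eq hi
  have e3 := h'.fst_eq hi
  have e4 := h'.snd_eq hi
  simp only [cross]
  linear_combination c' i * W'.2 * e1 - c' i * W'.1 * e2 - c i * W'.2 * e3 + c i * W'.1 * e4

theorem cross_eq_of_meet {s t : ℤ} (h : Q + s • W = Q' + t • W') :
    cross Q' W' = cross W W' * s + cross Q W' := by
  have e1 : Q.1 + s * W.1 = Q'.1 + t * W'.1 := by simpa using congrArg Prod.fst h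
  have e2 : Q.2 + s * W.2 = Q'.2 + t * W'.2 := by simpa using congrArg Prod.snd h
  simp only [cross]
  linear_combination W'.1 * e2 - W'.2 * e1

/-- Needed for `r = 3, 4`, where `r / 2 + 2 = r` and the pencil occupies every position. -/
theorem MeetsPencil.exists_pos_eq (h : MeetsPencil I V r Q W x c) (hI : I.card = r) {j : ℤ}
    (hj : 0 ≤ j ∧ j ≤ r - 1) : ∃ i ∈ I, x i = j := by
  classical
  have hsub : I.image x ⊆ Finset.Icc 0 (r - 1 : ℤ) := by
    intro z hz
    obtain ⟨i, hi, rfl⟩ := Finset.mem_image.1 hz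
    exact Finset.mem_Icc.2 (h.pos_mem i hi)
  have heq := Finset.eq_of_subset_of_card_le hsub (by
    rw [Finset.card_image_of_injOn h.inj, hI, Int.card_Icc]
    omega)
  have : j ∈ I.image x := heq ▸ Finset.mem_Icc.2 hj
  exact Finset.mem_image.1 this

/-! ### Two lines cannot coexist when `r` is 3, 4 or 6 -/

/-- The bounds allow only the ratios `c / c' = -1, 1/2, 1, 2`. At positions 0, 1, 2 these would form
a nonconstant arithmetic progression containing 1, the ratio at the meeting point; there is none. -/
theorem MeetsPencil.not_meetEachOther_three (h : MeetsPencil I V 3 Q W x c)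
    (h' : MeetsPencil I V 3 Q' W' y c') (hI : I.card = 3)
    (hm : MeetEachOther I 3 Q W c Q' W' c') : False := by
  obtain ⟨s, t, hs, -, hst⟩ := hm.meet
  have hD := cross_eq_of_meet hst
  have hD0 := h'.cross_ne
  have hα := hm.cross_ne
  generalize hα' : cross W W' = α at *
  generalize hγ : cross Q W' = γ at *
  generalize hD' : cross Q' W' = D at *
  have key : ∀ j : ℤ, 0 ≤ j ∧ j ≤ 2 → α * j + γ = -D ∨ α * j + γ = D ∨ α * j + γ = 2 * D ∨
      2 * (α * j + γ) = D := by
    intro j hj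
    obtain ⟨i, hi, rfl⟩ := h.exists_pos_eq hI (j := j) (by norm_num; exact hj)
    have e := h.mul_eq h' hi
    rw [hα', hγ, hD'] at e
    have h1 := h.le i hi
    have h2 := h'.le i hi
    have h3 := hm.sub_le i hi
    have h4 := h.ne_zero i hi
    have h5 := h'.ne_zero i hi
    generalize c i = a at *
    generalize c' i = b at *
    generalize α * x i + γ = u at *
    norm_num at h1 h2 h3
    obtain ⟨h1, h1'⟩ := h1
    obtain ⟨h2, h2'⟩ := h2
    interval_cases a <;> interval_cases b <;> omega
  have k0 := key 0 (by norm_num)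
  have k1 := key 1 (by norm_num)
  have k2 := key 2 (by norm_num)
  norm_num at hs
  obtain ⟨hs, hs'⟩ := hs
  interval_cases s <;> omega

/-- The positions undergo a cross-ratio preserving, non-affine permutation, and both possibilities
put the asymptote at `x = 3/2`. So `c' (2x - 3) = c (2s - 3)`, with `s` the meeting position. For
each `s` some `x` makes one of `c`, `c'` equal to `-3` times the other, and they differ by at least
4. -/
theorem MeetsPencil.not_meetEachOther_four (h : MeetsPencil I V 4 Q W x c)
    (h' : MeetsPencil I V 4 Q' W' y c') (hI : I.card = 4)
    (hm : MeetEachOther I 4 Q W c Q' W' c') : False := by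
  obtain ⟨s, t, hs, -, hst⟩ := hm.meet
  have hD := cross_eq_of_meet hst
  have hα := hm.cross_ne
  have hK : -(cross Q W * cross Q' W') ≠ 0 := neg_ne_zero.2 (mul_ne_zero h.cross_ne h'.cross_ne)
  obtain ⟨i0, m0, x0⟩ := h.exists_pos_eq hI (j := 0) (by norm_num)
  obtain ⟨i1, m1, x1⟩ := h.exists_pos_eq hI (j := 1) (by norm_num)
  obtain ⟨i2, m2, x2⟩ := h.exists_pos_eq hI (j := 2) (by norm_num)
  obtain ⟨i3, m3, x3⟩ := h.exists_pos_eq hI (j := 3) (by norm_num)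
  have hyp : ∀ i ∈ I, _ := fun i hi => h.hyperbola h' hi
  have hcr := hyperbola_crossRatio (x := ![x i0, x i1, x i2, x i3])
    (y := ![y i0, y i1, y i2, y i3]) hα hK (fun i => by fin_cases i <;> exact hyp _ (by assumption))
  have hnc := hyperbola_not_collinear (x := ![x i0, x i1, x i2])
    (y := ![y i0, y i1, y i2]) hα hK
    (by simp [x0, x1]) (by simp [x0, x2]) (by simp [x1, x2])
    (fun i => by fin_cases i <;> exact hyp _ (by assumption))
  have hcoe : ∀ i ∈ I, ∃ z : Fin 4, ((z : ℕ) : ℤ) = y i := fun i hi => by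
    have := h'.pos_mem i hi
    norm_num at this
    exact ⟨⟨(y i).toNat, by omega⟩, by simp; omega⟩
  obtain ⟨z0, hz0⟩ := hcoe i0 m0
  obtain ⟨z1, hz1⟩ := hcoe i1 m1
  obtain ⟨z2, hz2⟩ := hcoe i2 m2
  obtain ⟨z3, hz3⟩ := hcoe i3 m3
  have hne : ∀ i ∈ I, ∀ j ∈ I, x i ≠ x j → ∀ a b : Fin 4, ((a : ℕ) : ℤ) = y i →
      ((b : ℕ) : ℤ) = y j → a ≠ b := by
    rintro i hi j hj hij a b ha hb rfl
    exact hij (congrArg x (h'.inj hi hj (ha.symm.trans hb)))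
  have htab := crossRatio_four_table z0 z1 z2 z3 ⟨by
      simp [x0, x1, x2] at hnc
      simpa [hz0, hz1, hz2] using hnc, hne i0 m0 i1 m1 (by omega) _ _ hz0 hz1,
      hne i0 m0 i2 m2 (by omega) _ _ hz0 hz2, hne i0 m0 i3 m3 (by omega) _ _ hz0 hz3,
      hne i1 m1 i2 m2 (by omega) _ _ hz1 hz2, hne i1 m1 i3 m3 (by omega) _ _ hz1 hz3,
      hne i2 m2 i3 m3 (by omega) _ _ hz2 hz3, by
      simp [x0, x1, x2, x3] at hcr
      simp only [hz0, hz1, hz2, hz3]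
      linarith⟩
  simp only [hz0, hz1, hz2, hz3] at htab
  have y0 := hyp i0 m0
  have y1 := hyp i1 m1
  have y2 := hyp i2 m2
  have l0 := h.le i0 m0
  have l1 := h.le i1 m1
  have l2 := h.le i2 m2
  have l3 := h.le i3 m3
  have l0' := h'.le i0 m0
  have l1' := h'.le i1 m1
  have l2' := h'.le i2 m2
  have l3' := h'.le i3 m3
  have d0 := hm.sub_le i0 m0
  have d1 := hm.sub_le i1 m1
  have d2 := hm.sub_le i2 m2
  have d3 := hm.sub_le i3 m3
  have n0 := h.ne_zero i0 m0
  have n1 := h.ne_zero i1 m1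
  have n2 := h.ne_zero i2 m2
  have n3 := h.ne_zero i3 m3
  have hγ : 2 * cross Q W' = -(3 * cross W W') := by
    generalize cross W W' = α at *
    generalize cross Q W' = γ at *
    generalize cross W Q' = β at *
    rw [← y2] at y0 y1
    rw [x0, x2] at y0
    rw [x1, x2] at y1
    rcases htab with ⟨v0, v1, v2, v3⟩ | ⟨v0, v1, v2, v3⟩ <;> rw [v0, v2] at y0 <;>
      rw [v1, v2] at y1
    · have e1 : α * (2 * γ - 2 * β) = 0 := by linear_combination y0
      have e2 : γ = β := by linarith [(mul_eq_zero.1 e1).resolve_left hα]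
      subst e2
      have e3 : α * (2 * γ + 3 * α) = 0 := by linear_combination y1
      linarith [(mul_eq_zero.1 e3).resolve_left hα]
    · have e1 : α * (2 * γ + 6 * α + 2 * β) = 0 := by linear_combination -y0
      have e2 : β = -γ - 3 * α := by linarith [(mul_eq_zero.1 e1).resolve_left hα]
      subst e2
      have e3 : α * (2 * γ + 3 * α) = 0 := by linear_combination -y1
      linarith [(mul_eq_zero.1 e3).resolve_left hα]
  have hrel : ∀ i ∈ I, c' i * (2 * x i - 3) = c i * (2 * s - 3) := by
    intro i hi
    have e := h.mul_eq h' hi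
    rw [hD] at e
    have : cross W W' * (c' i * (2 * x i - 3) - c i * (2 * s - 3)) = 0 := by
      linear_combination 2 * e + (c i - c' i) * hγ
    linarith [(mul_eq_zero.1 this).resolve_left hα]
  have r0 := hrel i0 m0
  have r1 := hrel i1 m1
  have r2 := hrel i2 m2
  have r3 := hrel i3 m3
  rw [x0] at r0
  rw [x1] at r1
  rw [x2] at r2
  rw [x3] at r3
  norm_num at hs
  obtain ⟨hs, hs'⟩ := hs
  clear hcr hnc y0 y1 y2 hyp hrel htab hγ hst hD hα hK
  interval_cases s <;> omega

/-- Five of six positions are used on each line. Cross-ratio preservation for two quadruples with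
three common members already fails in every non-affine case. -/
theorem MeetsPencil.not_meetEachOther_six (h : MeetsPencil I V 6 Q W x c)
    (h' : MeetsPencil I V 6 Q' W' y c') (hI : I.card = 5)
    (hm : MeetEachOther I 6 Q W c Q' W' c') : False := by
  classical
  have hα := hm.cross_ne
  have hK : -(cross Q W * cross Q' W') ≠ 0 := neg_ne_zero.2 (mul_ne_zero h.cross_ne h'.cross_ne)
  have hcoe : ∀ T : ι → ℤ, (∀ i ∈ I, 0 ≤ T i ∧ T i ≤ (6 : ℕ) - 1) →
      ∀ i ∈ I, ∃ z : Fin 6, ((z : ℕ) : ℤ) = T i := fun T hT i hi => by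
    have := hT i hi
    norm_num at this
    exact ⟨⟨(T i).toNat, by omega⟩, by simp; omega⟩
  -- At most one position `e` is unoccupied; `e.succAbove` enumerates the rest in order.
  have himg : ∃ e : Fin 6, ∀ z : Fin 6, z ≠ e → ∃ i ∈ I, x i = ((z : ℕ) : ℤ) := by
    set X : Finset (Fin 6) := Finset.univ.filter (fun z => ∃ i ∈ I, x i = ((z : ℕ) : ℤ)) with hX
    have hle : 5 ≤ X.card := by
      rw [← hI, ← Finset.card_image_of_injOn h.inj,
        ← Finset.card_image_of_injective X (f := fun z : Fin 6 => ((z : ℕ) : ℤ))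
          (fun a b hab => by simpa [Fin.ext_iff] using hab)]
      refine Finset.card_le_card fun w hw => ?_
      obtain ⟨i, hi, rfl⟩ := Finset.mem_image.1 hw
      obtain ⟨z, hz⟩ := hcoe x h.pos_mem i hi
      exact Finset.mem_image.2 ⟨z, by simpa [hX] using ⟨i, hi, hz.symm⟩, hz⟩
    have hc : Xᶜ.card ≤ 1 := by
      rw [Finset.card_compl, Fintype.card_fin]
      omega
    rcases Nat.le_one_iff_eq_zero_or_eq_one.1 hc with h0 | h1
    · refine ⟨0, fun z _ => ?_⟩
      have : z ∉ Xᶜ := by simp [Finset.card_eq_zero.1 h0]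
      simpa [hX] using this
    · obtain ⟨e, he⟩ := Finset.card_eq_one.1 h1
      refine ⟨e, fun z hz => ?_⟩
      have : z ∉ Xᶜ := by simpa [he] using hz
      simpa [hX] using this
  obtain ⟨e, he⟩ := himg
  have hsel : ∀ n : Fin 5, ∃ i ∈ I, x i = ((e.succAbove n : ℕ) : ℤ) := fun n =>
    he _ (Fin.succAbove_ne e n)
  choose k hkI hkx using hsel
  have hyp : ∀ n, _ := fun n => h.hyperbola h' (hkI n)
  choose z hz using fun n => hcoe y h'.pos_mem (k n) (hkI n)
  have hxinj : Function.Injective (fun n => x (k n)) := by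
    intro m n hmn
    simp only [hkx] at hmn
    exact Fin.succAbove_right_injective (p := e) (Fin.ext (by exact_mod_cast hmn))
  have hzne : ∀ m n, m ≠ n → z m ≠ z n := by
    intro m n hmn hzz
    refine hmn (hxinj (congrArg x (h'.inj (hkI m) (hkI n) ?_)))
    rw [← hz, ← hz, hzz]
  have c3 := hyperbola_crossRatio (x := ![x (k 0), x (k 1), x (k 2), x (k 3)])
    (y := ![y (k 0), y (k 1), y (k 2), y (k 3)]) hα hK
    (fun i => by fin_cases i <;> exact hyp _)
  have c4 := hyperbola_crossRatio (x := ![x (k 0), x (k 1), x (k 2), x (k 4)])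
    (y := ![y (k 0), y (k 1), y (k 2), y (k 4)]) hα hK
    (fun i => by fin_cases i <;> exact hyp _)
  have hnc := hyperbola_not_collinear (x := ![x (k 0), x (k 1), x (k 2)])
    (y := ![y (k 0), y (k 1), y (k 2)]) hα hK
    (hxinj.ne (show (0 : Fin 5) ≠ 1 by decide)) (hxinj.ne (show (0 : Fin 5) ≠ 2 by decide))
    (hxinj.ne (show (1 : Fin 5) ≠ 2 by decide))
    (fun i => by fin_cases i <;> exact hyp _)
  simp [hkx, ← hz] at c3 c4 hnc
  have htab := crossRatio_six_table e (z 0) (z 1) (z 2) (z 3)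
  simp only at htab
  exact htab ⟨hnc, hzne _ _ (by decide),
    hzne _ _ (by decide), hzne _ _ (by decide), hzne _ _ (by decide), hzne _ _ (by decide),
    hzne _ _ (by decide), c3⟩ (z 4) (hzne _ _ (by decide)) (hzne _ _ (by decide))
    (hzne _ _ (by decide)) (hzne _ _ (by decide)) c4

end Pair

/-! ### The exceptional pair for `r = 5` -/

/-- The exceptional pair of lines meeting a pencil of four lines, in terms of vectors `e`, `e'`
along the two lines: they meet the pencil in `(d, b)` and `(a, 12 / d)` with `d = 2, 3, 4, 6`, up
to scaling, where `a * b = 12`. -/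
structure ExceptionalPair {ι : Type*} (V : ι → ℤ × ℤ) (c c' : ι → ℤ) (e e' : ℤ × ℤ) (a b : ℤ)
    (i j k l : ι) : Prop where
  primitive : IsCoprime e.1 e.2
  primitive' : IsCoprime e'.1 e'.2
  ne_ik : i ≠ k
  ne_jl : j ≠ l
  mul_eq : a * b = 12
  ge : 2 ≤ a
  le : a ≤ 6
  eq_i : c i • V i = (2 : ℤ) • e + b • e'
  eq_j : c j • V j = (3 : ℤ) • e + b • e'
  eq_k : c k • V k = (4 : ℤ) • e + b • e'
  eq_l : c l • V l = (6 : ℤ) • e + b • e'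
  eq_i' : c' i • V i = a • e + (6 : ℤ) • e'
  eq_j' : c' j • V j = a • e + (4 : ℤ) • e'
  eq_k' : c' k • V k = a • e + (3 : ℤ) • e'
  eq_l' : c' l • V l = a • e + (2 : ℤ) • e'

section Pair

variable {ι : Type*} {I : Finset ι} {V : ι → ℤ × ℤ} {r : ℕ} {Q W Q' W' : ℤ × ℤ} {x c y c' : ι → ℤ}

theorem ExceptionalPair.symm {e e' : ℤ × ℤ} {a b : ℤ} {i j k l : ι}
    (h : ExceptionalPair V c c' e e' a b i j k l) :
    ExceptionalPair V c' c e' e b a l k j i where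
  primitive := h.primitive'
  primitive' := h.primitive
  ne_ik := h.ne_jl.symm
  ne_jl := h.ne_ik.symm
  mul_eq := by rw [mul_comm, h.mul_eq]
  ge := by
    have := h.mul_eq
    have := h.ge
    have := h.le
    by_contra hb
    nlinarith
  le := by
    have := h.mul_eq
    have := h.ge
    have := h.le
    by_contra hb
    nlinarith
  eq_i := by rw [h.eq_l', add_comm]
  eq_j := by rw [h.eq_k', add_comm]
  eq_k := by rw [h.eq_j', add_comm]
  eq_l := by rw [h.eq_i', add_comm]
  eq_i' := by rw [h.eq_l, add_comm]
  eq_j' := by rw [h.eq_k, add_comm]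
  eq_k' := by rw [h.eq_j, add_comm]
  eq_l' := by rw [h.eq_i, add_comm]

/-- The asymptotes `γ = β = 2α` and the meeting point determine `Q` and `Q'` in the basis `W`, `W'`.
Then `K = a b α²`, while the point `(0, 4)` gives `K = 2 · 6 α²`. -/
theorem MeetsPencil.exceptionalPair_of_normalized (h : MeetsPencil I V r Q W x c)
    (h' : MeetsPencil I V r Q' W' y c') (hm : MeetEachOther I r Q W c Q' W' c')
    (hr : 5 ≤ r) (hr6 : r ≠ 6) (hI : I.card = r / 2 + 2)
    (hK : 0 < -(cross Q W * cross Q' W'))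
    (hu : ∀ i ∈ I, 0 < cross W W' * (cross W W' * x i + cross Q W')) :
    r = 5 ∧ ∃ e e' a b, ∃ i ∈ I, ∃ j ∈ I, ∃ k ∈ I, ∃ l ∈ I,
      ExceptionalPair V c c' e e' a b i j k l := by
  obtain ⟨rfl, hγ, hβ, i, hi, j, hj, k, hk, l, hl, ⟨xi, xj, xk, xl⟩, ⟨yi, yj, yk, yl⟩⟩ :=
    hyperbola_branch hr hr6 hI hK h.inj h.pos_mem h'.pos_mem hu (fun i hi => h.hyperbola h' hi)
  obtain ⟨s, t, hs, ht, hst⟩ := hm.meet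
  have hα := hm.cross_ne
  have e1 : Q.1 + s * W.1 = Q'.1 + t * W'.1 := by simpa using congrArg Prod.fst hst
  have e2 : Q.2 + s * W.2 = Q'.2 + t * W'.2 := by simpa using congrArg Prod.snd hst
  have hQ : Q = (2 : ℤ) • W + (t + 2) • W' := by
    rw [← sub_eq_zero]
    refine eq_zero_of_cross_eq_zero hα ?_ ?_
    · simp [cross] at *
      linear_combination hβ + W.1 * e2 - W.2 * e1
    · simp [cross] at *
      linear_combination hγ
  have hQ' : Q' = (s + 2) • W + (2 : ℤ) • W' := by
    rw [← sub_eq_zero]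
    refine eq_zero_of_cross_eq_zero hα ?_ ?_
    · simp [cross] at *
      linear_combination hβ
    · simp [cross] at *
      linear_combination hγ + W'.1 * e2 - W'.2 * e1
  refine ⟨rfl, W, W', s + 2, t + 2, i, hi, j, hj, k, hk, l, hl, h.primitive, h'.primitive,
    ?_, ?_, ?_, by omega, by omega, ?_, ?_, ?_, ?_, ?_, ?_, ?_, ?_⟩
  · rintro rfl
    omega
  · rintro rfl
    omega
  · have := h.hyperbola h' hi
    have hD : cross Q W = -((t + 2) * cross W W') := by
      rw [hQ]; simp [cross]; ring
    have hD' : cross Q' W' = (s + 2) * cross W W' := by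
      rw [hQ']; simp [cross]; ring
    rw [hD, hD', xi, yi, hγ, hβ] at this
    have h0 : cross W W' * cross W W' * ((s + 2) * (t + 2) - 12) = 0 := by
      linear_combination -this
    linarith [(mul_eq_zero.1 h0).resolve_left (mul_ne_zero hα hα)]
  · rw [← h.eq i hi, xi, hQ]; module
  · rw [← h.eq j hj, xj, hQ]; module
  · rw [← h.eq k hk, xk, hQ]; module
  · rw [← h.eq l hl, xl, hQ]; module
  · rw [← h'.eq i hi, yi, hQ']; module
  · rw [← h'.eq j hj, yj, hQ']; module
  · rw [← h'.eq k hk, yk, hQ']; module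
  · rw [← h'.eq l hl, yl, hQ']; module

/-- If no line of the pencil separates the directions of two lines meeting it, then only the
exceptional situation is possible. -/
theorem MeetsPencil.exceptionalPair (h : MeetsPencil I V r Q W x c)
    (h' : MeetsPencil I V r Q' W' y c') (hm : MeetEachOther I r Q W c Q' W' c')
    (hr : 5 ≤ r) (hr6 : r ≠ 6) (hI : I.card = r / 2 + 2)
    (hu : (∀ i ∈ I, 0 < cross W W' * x i + cross Q W') ∨
      ∀ i ∈ I, cross W W' * x i + cross Q W' < 0) :
    r = 5 ∧ ∃ e e' a b, ∃ i ∈ I, ∃ j ∈ I, ∃ k ∈ I, ∃ l ∈ I,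
      ExceptionalPair V c c' e e' a b i j k l := by
  -- Reversing the second line changes the sign of `K` but not of `α (α x + γ)`. Reversing the
  -- first, used below, changes the sign of `α` but not of `α x + γ`.
  have main : ∀ {Q W : ℤ × ℤ} {x : ι → ℤ} (h : MeetsPencil I V r Q W x c)
      (hm : MeetEachOther I r Q W c Q' W' c')
      (hu : ∀ i ∈ I, 0 < cross W W' * (cross W W' * x i + cross Q W')),
      r = 5 ∧ ∃ e e' a b, ∃ i ∈ I, ∃ j ∈ I, ∃ k ∈ I, ∃ l ∈ I,
        ExceptionalPair V c c' e e' a b i j k l := by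
    intro Q W x h hm hu
    have hK : -(cross Q W * cross Q' W') ≠ 0 := neg_ne_zero.2 (mul_ne_zero h.cross_ne h'.cross_ne)
    rcases lt_or_gt_of_ne hK with hK | hK
    · refine h.exceptionalPair_of_normalized h'.flip hm.symm.flip.symm hr hr6 hI ?_ ?_
      · have : cross (Q' + (r - 1 : ℤ) • W') (-W') = -cross Q' W' := by
          simp [cross]; ring
        rw [this]
        linarith
      · intro i hi
        have h1 : cross W (-W') = -cross W W' := by simp [cross]; ring
        have h2 : cross Q (-W') = -cross Q W' := by simp [cross]; ring
        rw [h1, h2]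
        linarith [hu i hi]
    · exact h.exceptionalPair_of_normalized h' hm hr hr6 hI hK hu
  have hflip : ∀ i, cross (-W) W' * (r - 1 - x i) + cross (Q + (r - 1 : ℤ) • W) W' =
      cross W W' * x i + cross Q W' := fun i => by
    simp [cross]; ring
  have hneg : cross (-W) W' = -cross W W' := by simp [cross]; ring
  rcases hu with hu | hu <;> rcases lt_or_gt_of_ne hm.cross_ne with hα | hα
  · refine main h.flip hm.flip fun i hi => ?_
    rw [hflip, hneg]
    exact mul_pos (by omega) (hu i hi)
  · exact main h hm fun i hi => mul_pos hα (hu i hi)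
  · exact main h hm fun i hi => mul_pos_of_neg_of_neg hα (hu i hi)
  · refine main h.flip hm.flip fun i hi => ?_
    rw [hflip, hneg]
    exact mul_pos_of_neg_of_neg (by omega) (hu i hi)

theorem not_isCoprime_of_dvd {v : ℤ × ℤ} {d : ℤ} (hd : 1 < d) (h1 : d ∣ v.1) (h2 : d ∣ v.2) :
    ¬ IsCoprime v.1 v.2 := fun h => by
  have := Int.isUnit_iff.1 (h.isUnit_of_dvd' h1 h2)
  omega

/-- A vector parallel to a primitive one is an integer multiple of it. -/
theorem exists_eq_smul_of_cross_eq_zero {v w : ℤ × ℤ} (hv : IsCoprime v.1 v.2)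
    (h : cross v w = 0) : ∃ n : ℤ, w = n • v := by
  obtain ⟨a, b, hab⟩ := hv
  simp only [cross] at h
  refine ⟨a * w.1 + b * w.2, Prod.ext ?_ ?_⟩
  · simp only [Prod.smul_fst, smul_eq_mul]
    linear_combination -w.1 * hab - b * h
  · simp only [Prod.smul_snd, smul_eq_mul]
    linear_combination -w.2 * hab + a * h

/-- If `a = 2` then `b = 6`, and the point on pencil line `l` is `6 (e + e')`. Since `V l` is
primitive, 6 divides `c l`, which is too small. -/
theorem ExceptionalPair.ne_two {e e' : ℤ × ℤ} {a b : ℤ} {i j k l : ι}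
    (h : ExceptionalPair V c c' e e' a b i j k l) (hV : IsCoprime (V l).1 (V l).2)
    (h0 : c l ≠ 0) (hc : -4 ≤ c l ∧ c l ≤ 4) : a ≠ 2 := by
  rintro rfl
  have hb : b = 6 := by have := h.mul_eq; omega
  subst hb
  have h1 := congrArg Prod.fst h.eq_l
  have h2 := congrArg Prod.snd h.eq_l
  simp at h1 h2
  obtain ⟨n, hn⟩ := exists_eq_smul_of_cross_eq_zero (w := e + e') hV (by
    have : c l * cross (V l) (e + e') = 0 := by
      simp only [cross, Prod.fst_add, Prod.snd_add]
      linear_combination (e.2 + e'.2) * h1 - (e.1 + e'.1) * h2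
    exact (mul_eq_zero.1 this).resolve_left h0)
  have n1 : e.1 + e'.1 = n * (V l).1 := by simpa using congrArg Prod.fst hn
  have n2 : e.2 + e'.2 = n * (V l).2 := by simpa using congrArg Prod.snd hn
  have k1 : (c l - 6 * n) * (V l).1 = 0 := by linear_combination h1 + 6 * n1
  have k2 : (c l - 6 * n) * (V l).2 = 0 := by linear_combination h2 + 6 * n2
  have hcn : c l = 6 * n := by
    by_contra hne
    have hne' : c l - 6 * n ≠ 0 := sub_ne_zero.2 hne
    refine not_isCoprime_of_dvd (v := V l) (d := 2) (by norm_num) ?_ ?_ hV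
    · rw [(mul_eq_zero.1 k1).resolve_left hne']; exact dvd_zero _
    · rw [(mul_eq_zero.1 k2).resolve_left hne']; exact dvd_zero _
  omega

/-- A line through the same pencil as an exceptional pair meets two lines of the pencil where one
of the pair does. -/
theorem ExceptionalPair.eq_or_eq_of_three {e e' : ℤ × ℤ} {b : ℤ} {i j k l : ι}
    (h : ExceptionalPair V c c' e e' 3 b i j k l) {Q'' W'' : ℤ × ℤ} {z c'' : ι → ℤ}
    (hV : ∀ n ∈ I, IsCoprime (V n).1 (V n).2)
    (hi : i ∈ I) (hj : j ∈ I) (hk : k ∈ I) (hl : l ∈ I)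
    (h1 : ∀ n ∈ I, c n ≠ 0 ∧ -4 ≤ c n ∧ c n ≤ 4)
    (h2 : ∀ n ∈ I, c' n ≠ 0 ∧ -4 ≤ c' n ∧ c' n ≤ 4)
    (h3 : MeetsPencil I V 5 Q'' W'' z c'')
    (h13 : ∀ n ∈ I, -4 ≤ c n - c'' n ∧ c n - c'' n ≤ 4)
    (h23 : ∀ n ∈ I, -4 ≤ c' n - c'' n ∧ c' n - c'' n ≤ 4) :
    (c'' i = c i ∧ c'' k = c k) ∨ (c'' i = c' i ∧ c'' k = c' k) := by
  have hb : b = 4 := by have := h.mul_eq; omega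
  subst hb
  have hcancel : ∀ n ∈ I, ∀ s t : ℤ, s • V n = t • V n → s = t := by
    intro n hn s t hst
    have hn0 : V n ≠ 0 := by
      intro h0
      refine not_isCoprime_of_dvd (v := V n) (d := 2) (by norm_num) ?_ ?_ (hV n hn) <;> simp [h0]
    exact smul_left_injective ℤ hn0 hst
  -- The pair meets line `i` in `2 (e + 2e')` and `3 (e + 2e')`, and line `k` in `4 (e + e')` and `3
  -- (e + e')`. As coordinates are at most 4 in size, `n` and `m` will be `±1`.
  obtain ⟨n, hn, ci, ci'⟩ :
      ∃ n : ℤ, n • V i = e + (2 : ℤ) • e' ∧ c i = 2 * n ∧ c' i = 3 * n := by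
    have hn : (c' i - c i) • V i = e + (2 : ℤ) • e' := by
      rw [sub_smul, h.eq_i, h.eq_i']; module
    refine ⟨_, hn, hcancel i hi _ _ ?_, hcancel i hi _ _ ?_⟩ <;> rw [mul_smul, hn]
    · rw [h.eq_i]; module
    · rw [h.eq_i']; module
  obtain ⟨m, hm, ck, ck'⟩ : ∃ m : ℤ, m • V k = e + e' ∧ c k = 4 * m ∧ c' k = 3 * m := by
    have hm : (c k - c' k) • V k = e + e' := by
      rw [sub_smul, h.eq_k, h.eq_k']; module
    refine ⟨_, hm, hcancel k hk _ _ ?_, hcancel k hk _ _ ?_⟩ <;> rw [mul_smul, hm]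
    · rw [h.eq_k]; module
    · rw [h.eq_k']; module
  have cl : c l = 2 * c' l := by
    refine hcancel l hl _ _ ?_
    rw [mul_smul, h.eq_l, h.eq_l']; module
  have hodd : ∀ w : ℤ × ℤ, ∀ s t : ℤ, s • w = (3 : ℤ) • e + (2 * t) • e' → ¬ (2 : ℤ) ∣ s := by
    rintro w s t hs ⟨q, rfl⟩
    have f1 := congrArg Prod.fst hs
    have f2 := congrArg Prod.snd hs
    simp only [Prod.fst_add, Prod.snd_add, Prod.smul_fst, Prod.smul_snd, smul_eq_mul] at f1 f2
    refine not_isCoprime_of_dvd (v := e) (d := 2) (by norm_num) ?_ ?_ h.primitive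
    · exact ⟨q * w.1 - e.1 - t * e'.1, by linear_combination -f1⟩
    · exact ⟨q * w.2 - e.2 - t * e'.2, by linear_combination -f2⟩
  -- The common point `3e + 4e'` is divisible neither by 2, as `e` is primitive, nor by 3, as `e'`
  -- is.
  have cj : c j = 1 ∨ c j = -1 := by
    have g1 := hodd (V j) (c j) 2 (by rw [h.eq_j]; module)
    have g2 : ¬ (3 : ℤ) ∣ c j := by
      rintro ⟨q, hq⟩
      have f1 := congrArg Prod.fst h.eq_j
      have f2 := congrArg Prod.snd h.eq_j
      rw [hq] at f1 f2
      simp only [Prod.fst_add, Prod.snd_add, Prod.smul_fst, Prod.smul_snd, smul_eq_mul] at f1 f2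
      refine not_isCoprime_of_dvd (v := e') (d := 3) (by norm_num) ?_ ?_ h.primitive'
      · exact ⟨q * (V j).1 - e.1 - e'.1, by linear_combination -f1⟩
      · exact ⟨q * (V j).2 - e.2 - e'.2, by linear_combination -f2⟩
    have := h1 j hj
    omega
  have hp : c' l = 1 ∨ c' l = -1 := by
    have g1 := hodd (V l) (c' l) 1 (by rw [h.eq_l']; module)
    have := h1 l hl
    have := h2 l hl
    omega
  have hn1 : n = 1 ∨ n = -1 := by
    have := h2 i hi
    omega
  have hm1 : m = 1 ∨ m = -1 := by
    have := h2 k hk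
    omega
  have hD : ∀ q ∈ I, ∀ s : ℤ, ∀ w : ℤ × ℤ, s • V q = w →
      c'' q * cross w W'' = s * cross Q'' W'' := by
    rintro q hq s w rfl
    have f1 := h3.fst_eq hq
    have f2 := h3.snd_eq hq
    simp only [cross, Prod.smul_fst, Prod.smul_snd, smul_eq_mul]
    linear_combination s * W''.1 * f2 - s * W''.2 * f1
  have di := hD i hi _ _ hn
  have dk := hD k hk _ _ hm
  have dj := hD j hj _ _ h.eq_j
  have dl := hD l hl _ _ h.eq_l'
  have hD0 := h3.cross_ne
  have L : ∀ s t : ℤ, cross (s • e + t • e') W'' = s * cross e W'' + t * cross e' W'' := by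
    intro s t
    simp [cross]
    ring
  have L2 : cross (e + (2 : ℤ) • e') W'' = cross e W'' + 2 * cross e' W'' := by
    simp [cross]
    ring
  have L1 : cross (e + e') W'' = cross e W'' + cross e' W'' := by
    simp [cross]
    ring
  rw [L] at dj dl
  rw [L2] at di
  rw [L1] at dk
  generalize cross Q'' W'' = D at *
  generalize cross e W'' = A at *
  generalize cross e' W'' = B at *
  have bi := h3.le i hi
  have bj := h3.le j hj
  have bk := h3.le k hk
  have bl := h3.le l hl
  have ni := h3.ne_zero i hi
  have nj := h3.ne_zero j hj
  have nk := h3.ne_zero k hk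
  have nl := h3.ne_zero l hl
  have si := h13 i hi
  have sj := h13 j hj
  have sk := h13 k hk
  have sl := h13 l hl
  have si' := h23 i hi
  have sj' := h23 j hj
  have sk' := h23 k hk
  have sl' := h23 l hl
  have nn : n * n = 1 := by rcases hn1 with rfl | rfl <;> rfl
  have mm : m * m = 1 := by rcases hm1 with rfl | rfl <;> rfl
  have jj : c j * c j = 1 := by rcases cj with h | h <;> rw [h] <;> rfl
  have pp : c' l * c' l = 1 := by rcases hp with h | h <;> rw [h] <;> rfl
  -- Coordinates of the third line after orienting the pencil lines along `e + 2e'`, `3e + 4e'`, `e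
  -- + e'`, `3e + 2e'`. The reciprocals are values of one linear form, so two of them determine the
  -- others.
  obtain ⟨a0, h0⟩ : ∃ a0, a0 = c'' i * n := ⟨_, rfl⟩
  obtain ⟨a1, h1'⟩ : ∃ a1, a1 = c'' j * c j := ⟨_, rfl⟩
  obtain ⟨a2, h2'⟩ : ∃ a2, a2 = c'' k * m := ⟨_, rfl⟩
  obtain ⟨a3, h3'⟩ : ∃ a3, a3 = c'' l * c' l := ⟨_, rfl⟩
  have d0 : a0 * (A + 2 * B) = D := by rw [h0]; linear_combination n * di + D * nn
  have d1 : a1 * (3 * A + 4 * B) = D := by rw [h1']; linear_combination c j * dj + D * jj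
  have d2 : a2 * (A + B) = D := by rw [h2']; linear_combination m * dk + D * mm
  have d3 : a3 * (3 * A + 2 * B) = D := by rw [h3']; linear_combination c' l * dl + D * pp
  have r1 : a1 * (a2 + 2 * a0) = a0 * a2 := by
    refine mul_right_cancel₀ hD0 ?_
    linear_combination a0 * a2 * d1 - a1 * a2 * d0 - 2 * a1 * a0 * d2
  have r3 : a3 * (4 * a0 - a2) = a0 * a2 := by
    refine mul_right_cancel₀ hD0 ?_
    linear_combination a0 * a2 * d3 + a3 * a2 * d0 - 4 * a3 * a0 * d2
  -- In this orientation the pair has coordinates (2, 1, 4, 2) and (3, 1, 3, 1), and the third line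
  -- stays within 4 of both.
  have b0 : -1 ≤ a0 ∧ a0 ≤ 4 ∧ a0 ≠ 0 := by
    rcases hn1 with rfl | rfl <;> omega
  have b2 : 1 ≤ a2 ∧ a2 ≤ 4 := by
    rcases hm1 with rfl | rfl <;> omega
  have b1 : -3 ≤ a1 ∧ a1 ≤ 4 ∧ a1 ≠ 0 := by
    rcases cj with h | h <;> rw [h] at h1' sj <;> omega
  have b3 : -2 ≤ a3 ∧ a3 ≤ 4 ∧ a3 ≠ 0 := by
    rcases hp with h | h <;> rw [h] at h3' cl <;> omega
  have hfin : (a0 = 2 ∧ a2 = 4) ∨ (a0 = 3 ∧ a2 = 3) := by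
    obtain ⟨b0, b0', b0''⟩ := b0
    obtain ⟨b2, b2'⟩ := b2
    clear h0 h1' h2' h3' d0 d1 d2 d3
    interval_cases a0 <;> interval_cases a2 <;> omega
  rcases hn1 with rfl | rfl <;> rcases hm1 with rfl | rfl <;> omega

end Pair

/-! ### Counting the lines that miss the centre of the pencil -/

section Family

variable {ι μ : Type*} {I : Finset ι} {V : ι → ℤ × ℤ} {r : ℕ} {M : Finset μ} {Q W : μ → ℤ × ℤ}
  {x c : μ → ι → ℤ}

/-- Among more lines than there are in a pencil that they all meet, two have directions that are
not separated by any line of the pencil. -/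
theorem exists_not_separated (hI : I.Nonempty)
    (h : ∀ l ∈ M, MeetsPencil I V r (Q l) (W l) (x l) (c l)) (hcard : I.card < M.card) :
    ∃ l ∈ M, ∃ l' ∈ M, l ≠ l' ∧
      ((∀ i ∈ I, 0 < cross (W l) (W l') * x l i + cross (Q l) (W l')) ∨
        ∀ i ∈ I, cross (W l) (W l') * x l i + cross (Q l) (W l') < 0) := by
  classical
  obtain ⟨o, ho⟩ : M.Nonempty := Finset.card_pos.1 (by omega)
  obtain ⟨m, hm, hmin⟩ := Finset.exists_min_image I (x o) hI
  have hV : ∀ l ∈ M, ∀ i ∈ I, ∀ w, cross (W l) w * x l i + cross (Q l) w =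
      c l i * cross (V i) w := by
    intro l hl i hi w
    have e1 := (h l hl).fst_eq hi
    have e2 := (h l hl).snd_eq hi
    simp only [cross]
    linear_combination w.2 * e1 - w.1 * e2
  have hD : ∀ l ∈ M, ∀ i ∈ I, cross (Q l) (W l) = c l i * cross (V i) (W l) := by
    intro l hl i hi
    rw [← hV l hl i hi]
    simp only [cross]
    ring
  -- For fixed `l` this is affine in the position `x o i` on the reference line `o`, so its sign
  -- changes at most once along `o`.
  set g : μ → ι → ℤ := fun l i => c o i * cross (V i) (W l) with hg
  have hg' : ∀ l, ∀ i ∈ I, g l i = cross (W o) (W l) * x o i + cross (Q o) (W l) :=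
    fun l i hi => (hV o ho i hi (W l)).symm
  have hgne : ∀ l ∈ M, ∀ i ∈ I, g l i ≠ 0 := by
    intro l hl i hi
    refine mul_ne_zero ((h o ho).ne_zero i hi) fun h0 => (h l hl).cross_ne ?_
    rw [hD l hl i hi, h0, mul_zero]
  -- The pencil lines beyond the sign change: a final segment omitting the first line `m`. Its
  -- cardinality determines it and takes at most `I.card` values.
  set S : μ → Finset ι := fun l => I.filter (fun i => g l i * g l m < 0) with hS
  have hup : ∀ l ∈ M, ∀ i ∈ S l, ∀ j ∈ I, x o i ≤ x o j → j ∈ S l := by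
    intro l hl i hi j hj hij
    simp only [hS, Finset.mem_filter] at hi ⊢
    obtain ⟨hi, hneg⟩ := hi
    refine ⟨hj, ?_⟩
    have hmi := hmin i hi
    rw [hg' l i hi, hg' l m hm] at hneg
    rw [hg' l j hj, hg' l m hm]
    generalize cross (W o) (W l) = α at *
    generalize cross (Q o) (W l) = γ at *
    rcases mul_neg_iff.1 hneg with ⟨h1, h2⟩ | ⟨h1, h2⟩
    · have hα : 0 ≤ α := by
        by_contra hα
        have := mul_le_mul_of_nonpos_left hmi (not_le.1 hα).le
        linarith
      have := mul_le_mul_of_nonneg_left hij hα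
      exact mul_neg_of_pos_of_neg (by linarith) h2
    · have hα : α ≤ 0 := by
        by_contra hα
        have := mul_le_mul_of_nonneg_left hmi (not_le.1 hα).le
        linarith
      have := mul_le_mul_of_nonpos_left hij hα
      exact mul_neg_of_neg_of_pos (by linarith) h2
  have hchain : ∀ l ∈ M, ∀ l' ∈ M, (S l).card = (S l').card → S l ⊆ S l' := by
    intro l hl l' hl' hcard'
    by_contra hsub
    obtain ⟨i, hi, hi'⟩ := Finset.not_subset.1 hsub
    have : S l' ⊂ S l := by
      refine Finset.ssubset_iff_subset_ne.2 ⟨fun j hj => ?_, fun heq => hi' (heq ▸ hi)⟩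
      refine hup l hl i hi j (Finset.mem_filter.1 hj).1 ?_
      by_contra hlt
      exact hi' (hup l' hl' j hj i (Finset.mem_filter.1 hi).1 (not_le.1 hlt).le)
    have := Finset.card_lt_card this
    omega
  have hmaps : ∀ l ∈ M, (S l).card ∈ Finset.range I.card := by
    intro l hl
    rw [Finset.mem_range]
    refine Finset.card_lt_card (Finset.ssubset_iff_subset_ne.2 ⟨Finset.filter_subset _ _, ?_⟩)
    intro heq
    have : m ∈ S l := heq ▸ hm
    exact absurd (Finset.mem_filter.1 this).2 (mul_self_nonneg _).not_gt
  obtain ⟨l, hl, l', hl', hne, heq⟩ := Finset.exists_ne_map_eq_of_card_lt_of_maps_to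
    (by rwa [Finset.card_range]) hmaps
  have hSS : S l = S l' := (hchain l hl l' hl' heq).antisymm (hchain l' hl' l hl heq.symm)
  refine ⟨l, hl, l', hl', hne, ?_⟩
  have hsign : ∀ i ∈ I, 0 < (g l i * g l m) * (g l' i * g l' m) := by
    intro i hi
    have hiff : g l i * g l m < 0 ↔ g l' i * g l' m < 0 := by
      have : i ∈ S l ↔ i ∈ S l' := by rw [hSS]
      simpa [hS, hi] using this
    have n1 := mul_ne_zero (hgne l hl i hi) (hgne l hl m hm)
    have n2 := mul_ne_zero (hgne l' hl' i hi) (hgne l' hl' m hm)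
    rcases lt_or_gt_of_ne n1 with h1 | h1
    · exact mul_pos_of_neg_of_neg h1 (hiff.1 h1)
    · exact mul_pos h1 (lt_of_le_of_ne (not_lt.1 fun h2 => h1.not_gt (hiff.2 h2)) n2.symm)
  -- The second factor does not depend on `i`, so it fixes the sign of the first.
  have hu : ∀ i ∈ I, 0 < (cross (W l) (W l') * x l i + cross (Q l) (W l')) *
      (cross (Q l) (W l) * (g l m * g l' m)) := by
    intro i hi
    have h1 := hsign i hi
    have hc0 : 0 < c o i * c o i := mul_self_pos.2 ((h o ho).ne_zero i hi)
    have hc : 0 < c l i * c l i := mul_self_pos.2 ((h l hl).ne_zero i hi)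
    rw [hV l hl i hi, hD l hl i hi]
    refine (mul_pos_iff_of_pos_left hc0).1 ?_
    have h2 := mul_pos hc h1
    convert h2 using 1
    simp only [hg]
    ring
  rcases lt_trichotomy (cross (Q l) (W l) * (g l m * g l' m)) 0 with h0 | h0 | h0
  · refine Or.inr fun i hi => ?_
    rcases mul_pos_iff.1 (hu i hi) with h1 | h1
    · exact absurd h0 h1.2.not_gt
    · exact h1.1
  · exact absurd (hu m hm) (by rw [h0]; simp)
  · exact Or.inl fun i hi => (mul_pos_iff_of_pos_right h0).1 (hu i hi)

/-- More than `2 ((r - 1) / 2)` lines outnumber the `r / 2 + 2` pencil lines except for `r = 3, 4,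
6`, where two lines already give a contradiction. For `r = 5` there are at least five lines, hence a
third one beside the exceptional pair; it agrees with one of the pair at two points. -/
theorem card_le_of_meetsPencil (hr : 3 ≤ r) (hI : I.card = r / 2 + 2)
    (hV : ∀ i ∈ I, IsCoprime (V i).1 (V i).2)
    (h : ∀ l ∈ M, MeetsPencil I V r (Q l) (W l) (x l) (c l))
    (hm : ∀ l ∈ M, ∀ l' ∈ M, l ≠ l' → MeetEachOther I r (Q l) (W l) (c l) (Q l') (W l') (c l'))
    (heq : ∀ l ∈ M, ∀ l' ∈ M, ∀ i ∈ I, ∀ k ∈ I, i ≠ k → c l i = c l' i → c l k = c l' k → l = l') :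
    M.card ≤ 2 * ((r - 1) / 2) := by
  classical
  by_contra hcon
  rw [not_le] at hcon
  by_cases hsmall : r = 3 ∨ r = 4 ∨ r = 6
  · obtain ⟨l, hl, l', hl', hne⟩ := Finset.one_lt_card.1 (show 1 < M.card by omega)
    rcases hsmall with rfl | rfl | rfl
    · exact (h l hl).not_meetEachOther_three (h l' hl') hI (hm l hl l' hl' hne)
    · exact (h l hl).not_meetEachOther_four (h l' hl') hI (hm l hl l' hl' hne)
    · exact (h l hl).not_meetEachOther_six (h l' hl') hI (hm l hl l' hl' hne)
  obtain ⟨l, hl, l', hl', hne, hsep⟩ := exists_not_separated (Finset.card_pos.1 (by omega)) h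
    (by omega)
  obtain ⟨rfl, e, e', a, b, i, hi, j, hj, k, hk, n, hn, hex⟩ :=
    (h l hl).exceptionalPair (h l' hl') (hm l hl l' hl' hne) (by omega) (by omega) hI hsep
  have hc : ∀ l ∈ M, ∀ i ∈ I, c l i ≠ 0 ∧ -4 ≤ c l i ∧ c l i ≤ 4 := fun l hl i hi => by
    have := (h l hl).le i hi
    have := (h l hl).ne_zero i hi
    omega
  have hcc : ∀ l ∈ M, ∀ l' ∈ M, l ≠ l' → ∀ i ∈ I, -4 ≤ c l i - c l' i ∧ c l i - c l' i ≤ 4 :=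
    fun l hl l' hl' hne i hi => by
    have := (hm l hl l' hl' hne).sub_le i hi
    omega
  obtain ⟨l'', hl'', hne''⟩ : ∃ l'' ∈ M, l'' ∉ ({l, l'} : Finset μ) :=
    Finset.exists_mem_notMem_of_card_lt_card (by
      have := Finset.card_le_two (a := l) (b := l')
      omega)
  simp only [Finset.mem_insert, Finset.mem_singleton, not_or] at hne''
  obtain ⟨hne1, hne2⟩ := hne''
  have h2 := hex.ne_two (hV n hn) (hc l hl n hn).1 (hc l hl n hn).2
  have h2' := hex.symm.ne_two (hV i hi) (hc l' hl' i hi).1 (hc l' hl' i hi).2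
  have hab : a = 3 ∨ b = 3 := by
    have h12 := hex.mul_eq
    have hge := hex.ge
    have hle := hex.le
    clear hex
    interval_cases a <;> omega
  rcases hab with rfl | rfl
  · rcases hex.eq_or_eq_of_three hV hi hj hk hn (hc l hl) (hc l' hl') (h l'' hl'')
      (hcc l hl l'' hl'' (Ne.symm hne1)) (hcc l' hl' l'' hl'' (Ne.symm hne2)) with ⟨h1, h2⟩ | ⟨h1, h2⟩
    · exact hne1 (heq l'' hl'' l hl i hi k hk hex.ne_ik h1 h2)
    · exact hne2 (heq l'' hl'' l' hl' i hi k hk hex.ne_ik h1 h2)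
  · rcases hex.symm.eq_or_eq_of_three hV hn hk hj hi (hc l' hl') (hc l hl) (h l'' hl'')
      (hcc l' hl' l'' hl'' (Ne.symm hne2)) (hcc l hl l'' hl'' (Ne.symm hne1)) with ⟨h1, h2⟩ | ⟨h1, h2⟩
    · exact hne2 (heq l'' hl'' l' hl' n hn j hj hex.ne_jl.symm h1 h2)
    · exact hne1 (heq l'' hl'' l hl n hn j hj hex.ne_jl.symm h1 h2)

end Family

/-! ### From segment systems to pencils, and covering by points -/

theorem IsConsecutiveOnLine.exists_param {r : ℕ} {s : Finset (ℤ × ℤ)} (h : IsConsecutiveOnLine r s) :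
    ∃ a v : ℤ × ℤ, IsCoprime v.1 v.2 ∧
      ∀ z, z ∈ s ↔ ∃ n : ℤ, (0 ≤ n ∧ n ≤ r - 1) ∧ z = a + n • v := by
  obtain ⟨a, v, hv, rfl⟩ := h
  refine ⟨a, v, hv, fun z => ?_⟩
  simp only [Finset.mem_image, Finset.mem_range]
  constructor
  · rintro ⟨i, hi, rfl⟩
    exact ⟨i, by omega, rfl⟩
  · rintro ⟨n, hn, rfl⟩
    refine ⟨n.toNat, by omega, ?_⟩
    rw [Int.toNat_of_nonneg hn.1]

namespace LinearSystem

section General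

variable {α : Type*} [DecidableEq α] {S : LinearSystem α}

theorem eq_of_mem_of_mem {l l' : Finset α} (hl : l ∈ S.lines) (hl' : l' ∈ S.lines) {z z' : α}
    (hz : z ∈ l) (hz' : z' ∈ l) (hzl' : z ∈ l') (hzl'' : z' ∈ l') (hne : z ≠ z') : l = l' := by
  by_contra h
  have h1 := S.card_inter_le_one l hl l' hl' h
  have h2 : 1 < (l ∩ l').card := Finset.one_lt_card.2
    ⟨z, Finset.mem_inter.2 ⟨hz, hzl'⟩, z', Finset.mem_inter.2 ⟨hz', hzl''⟩, hne⟩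
  omega

theorem IsIntersecting.exists_mem (h : S.IsIntersecting) {l l' : Finset α} (hl : l ∈ S.lines)
    (hl' : l' ∈ S.lines) (hne : l ≠ l') : ∃ z, z ∈ l ∧ z ∈ l' := by
  obtain ⟨z, hz⟩ := Finset.card_pos.1 (by rw [h l hl l' hl' hne]; exact one_pos)
  exact ⟨z, Finset.mem_inter.1 hz⟩

/-- Pairwise intersecting lines can be covered two at a time. -/
theorem IsIntersecting.exists_cover (h : S.IsIntersecting) (hne : ∀ l ∈ S.lines, l.Nonempty) :
    ∀ (n : ℕ) (M : Finset (Finset α)), M ⊆ S.lines → M.card ≤ 2 * n →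
      ∃ T ⊆ S.points, T.card ≤ n ∧ ∀ l ∈ M, (T ∩ l).Nonempty := by
  intro n
  induction n with
  | zero =>
    intro M _ hM
    have : M = ∅ := Finset.card_eq_zero.1 (by omega)
    subst this
    exact ⟨∅, by simp, by simp, by simp⟩
  | succ n ih =>
    intro M hMS hM
    rcases M.eq_empty_or_nonempty with rfl | ⟨l, hl⟩
    · exact ⟨∅, by simp, by simp, by simp⟩
    obtain ⟨z, hzl, N, hN, hNM, hcov⟩ : ∃ z ∈ l, ∃ N : Finset (Finset α), N.card ≤ 2 * n ∧ N ⊆ M ∧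
        ∀ k ∈ M, z ∈ k ∨ k ∈ N := by
      have hc := Finset.card_erase_of_mem hl
      rcases (M.erase l).eq_empty_or_nonempty with h0 | ⟨l', hl'⟩
      · obtain ⟨z, hz⟩ := hne l (hMS hl)
        refine ⟨z, hz, ∅, by simp, by simp, fun k hk => Or.inl ?_⟩
        by_cases hkl : k = l
        · rwa [hkl]
        · have : k ∈ M.erase l := Finset.mem_erase.2 ⟨hkl, hk⟩
          simp [h0] at this
      · have hl'2 := Finset.mem_erase.1 hl'
        obtain ⟨z, hz, hz'⟩ := h.exists_mem (hMS hl) (hMS hl'2.2) hl'2.1.symm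
        have hc' := Finset.card_erase_of_mem hl'
        refine ⟨z, hz, (M.erase l).erase l', by omega,
          (Finset.erase_subset _ _).trans (Finset.erase_subset _ _), fun k hk => ?_⟩
        by_cases hkl : k = l
        · left
          rwa [hkl]
        · by_cases hkl' : k = l'
          · left
            rwa [hkl']
          · right
            simp [hkl, hkl', hk]
    obtain ⟨T, hTS, hT, hTN⟩ := ih N (hNM.trans hMS) hN
    refine ⟨insert z T, ?_, (Finset.card_insert_le _ _).trans (by omega), fun k hk => ?_⟩
    · exact Finset.insert_subset (S.lines_subset l (hMS hl) hzl) hTS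
    · rcases hcov k hk with hz | hkN
      · exact ⟨z, by simp [hz]⟩
      · obtain ⟨w, hw⟩ := hTN k hkN
        exact ⟨w, by simp at hw ⊢; exact ⟨Or.inr hw.1, hw.2⟩⟩

/-- A point lies on at most two lines of a 2-packing. -/
theorem IsTwoPacking.card_le {R : Finset (Finset α)} (hR : S.IsTwoPacking R) {T : Finset α}
    (hT : S.IsTransversal T) : R.card ≤ 2 * T.card := by
  have hsub : R ⊆ T.biUnion (fun t => R.filter (fun l => t ∈ l)) := by
    intro l hl
    obtain ⟨t, ht⟩ := hT.2 l (hR.1 hl)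
    rw [Finset.mem_inter] at ht
    exact Finset.mem_biUnion.2 ⟨t, ht.1, Finset.mem_filter.2 ⟨hl, ht.2⟩⟩
  refine (Finset.card_le_card hsub).trans ?_
  rw [mul_comm]
  refine Finset.card_biUnion_le_card_mul _ _ _ fun t _ => ?_
  by_contra hcon
  obtain ⟨a, b, c, ha, hb, hc, hab, hac, hbc⟩ := Finset.two_lt_card_iff.1 (not_le.1 hcon)
  simp only [Finset.mem_filter] at ha hb hc
  exact hR.2 a ha.1 b hb.1 c hc.1 hab hac hbc ⟨t, ha.2, hb.2, hc.2⟩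

end General

/-- Distinct intersecting segments have different directions. -/
theorem IsSegmentSystem.cross_ne_zero {S : LinearSystem (ℤ × ℤ)} {r : ℕ} (hS : S.IsSegmentSystem r)
    (hint : S.IsIntersecting) {l l' : Finset (ℤ × ℤ)} (hl : l ∈ S.lines) (hl' : l' ∈ S.lines)
    (hne : l ≠ l') {a v a' v' : ℤ × ℤ} (hv : IsCoprime v.1 v.2)
    (h : ∀ z ∈ l, ∃ n : ℤ, z = a + n • v) (h' : ∀ z ∈ l', ∃ n : ℤ, z = a' + n • v') :
    cross v v' ≠ 0 := by
  intro h0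
  obtain ⟨k, rfl⟩ := exists_eq_smul_of_cross_eq_zero hv h0
  obtain ⟨z, hz, hz'⟩ := hint.exists_mem hl hl' hne
  -- Parallel segments sharing `z` would lie on one real line through `z`.
  refine hne (hS.unique_on_line
    (AffineSubspace.mk' (toRealPlane z) (Submodule.span ℝ {toRealPlane v})) ?_ l hl l' hl' ?_ ?_)
  · rw [AffineSubspace.direction_mk']
    refine finrank_span_singleton fun hv0 => ?_
    simp only [toRealPlane, Prod.mk_eq_zero, Int.cast_eq_zero] at hv0
    rw [hv0.1, hv0.2] at hv
    exact not_isCoprime_zero_zero hv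
  · intro y hy
    obtain ⟨n, rfl⟩ := h z hz
    obtain ⟨m, rfl⟩ := h y hy
    rw [AffineSubspace.mem_mk', vsub_eq_sub, Submodule.mem_span_singleton]
    refine ⟨m - n, ?_⟩
    simp [toRealPlane]
    constructor <;> ring
  · intro y hy
    obtain ⟨n, rfl⟩ := h' z hz'
    obtain ⟨m, rfl⟩ := h' y hy
    rw [AffineSubspace.mem_mk', vsub_eq_sub, Submodule.mem_span_singleton]
    refine ⟨(m - n) * k, ?_⟩
    simp [toRealPlane]
    constructor <;> ring

/-- If a point of an intersecting segment system has degree more than about `r / 2`, few lines miss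
that point. -/
theorem IsSegmentSystem.card_filter_notMem_le {S : LinearSystem (ℤ × ℤ)} {r : ℕ}
    (hS : S.IsSegmentSystem r) (hint : S.IsIntersecting) (hr : 3 ≤ r) {p : ℤ × ℤ}
    (hp : r / 2 + 2 ≤ S.degree p) :
    (S.lines.filter (fun l => p ∉ l)).card ≤ 2 * ((r - 1) / 2) := by
  classical
  obtain ⟨I, hIsub, hI⟩ := Finset.exists_subset_card_eq hp
  have hIl : ∀ i ∈ I, i ∈ S.lines ∧ p ∈ i := fun i hi => Finset.mem_filter.1 (hIsub hi)
  have hpar : ∀ l : Finset (ℤ × ℤ), ∃ a v : ℤ × ℤ, l ∈ S.lines → IsCoprime v.1 v.2 ∧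
      ∀ z, z ∈ l ↔ ∃ n : ℤ, (0 ≤ n ∧ n ≤ r - 1) ∧ z = a + n • v := fun l => by
    by_cases hl : l ∈ S.lines
    · obtain ⟨a, v, h⟩ := (hS.consecutive l hl).exists_param
      exact ⟨a, v, fun _ => h⟩
    · exact ⟨0, 0, fun h => absurd h hl⟩
  choose a v hav using hpar
  have hcross : ∀ l ∈ S.lines, ∀ l' ∈ S.lines, l ≠ l' → cross (v l) (v l') ≠ 0 :=
    fun l hl l' hl' hne => hS.cross_ne_zero hint hl hl' hne (a := a l) (a' := a l') (hav l hl).1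
      (fun z hz => by
        obtain ⟨n, -, h⟩ := ((hav l hl).2 z).1 hz
        exact ⟨n, h⟩)
      (fun z hz => by
        obtain ⟨n, -, h⟩ := ((hav l' hl').2 z).1 hz
        exact ⟨n, h⟩)
  have horig : ∀ i, ∃ n : ℤ, i ∈ I → (0 ≤ n ∧ n ≤ r - 1) ∧ p = a i + n • v i := fun i => by
    by_cases hi : i ∈ I
    · obtain ⟨n, h⟩ := ((hav i (hIl i hi).1).2 p).1 (hIl i hi).2
      exact ⟨n, fun _ => h⟩
    · exact ⟨0, fun h => absurd h hi⟩
  choose o ho using horig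
  set M := S.lines.filter (fun l => p ∉ l) with hM
  have hMl : ∀ l ∈ M, l ∈ S.lines ∧ p ∉ l := fun l hl => Finset.mem_filter.1 hl
  -- `c` is measured from `p`, which has position `o i` on line `i`. For all `l` the values `o i +
  -- c` lie in the same window of `r` integers, which bounds both `c` and differences of two such
  -- `c`.
  have hxc : ∀ l i, ∃ x c : ℤ, l ∈ M → i ∈ I → (0 ≤ x ∧ x ≤ r - 1) ∧
      (0 ≤ o i + c ∧ o i + c ≤ r - 1) ∧ a l - p + x • v l = c • v i ∧
      p + c • v i ∈ l ∧ p + c • v i ∈ i := fun l i => by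
    by_cases h : l ∈ M ∧ i ∈ I
    · obtain ⟨hl, hi⟩ := h
      obtain ⟨z, hzl, hzi⟩ := hint.exists_mem (hMl l hl).1 (hIl i hi).1 (by
        rintro rfl
        exact (hMl l hl).2 (hIl l hi).2)
      obtain ⟨x, hx, hzx⟩ := ((hav l (hMl l hl).1).2 z).1 hzl
      obtain ⟨m, hm, hzm⟩ := ((hav i (hIl i hi).1).2 z).1 hzi
      have hpo := (ho i hi).2
      have hz : z = p + (m - o i) • v i := by
        rw [hzm, hpo]
        module
      refine ⟨x, m - o i, fun _ _ => ⟨hx, by omega, ?_, hz ▸ hzl, hz ▸ hzi⟩⟩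
      have : a l - p + x • v l = z - p := by rw [hzx]; abel
      rw [this, hz]
      abel
    · exact ⟨0, 0, fun h1 h2 => absurd ⟨h1, h2⟩ h⟩
  choose x c hxc using hxc
  have hc0 : ∀ l ∈ M, ∀ i ∈ I, c l i ≠ 0 := by
    intro l hl i hi h0
    have := (hxc l i hl hi).2.2.2.1
    rw [h0, zero_smul, add_zero] at this
    exact (hMl l hl).2 this
  have hv0 : ∀ l ∈ S.lines, v l ≠ 0 := by
    intro l hl h0
    have := (hav l hl).1
    rw [h0] at this
    exact not_isCoprime_zero_zero this
  have hinj : ∀ l ∈ M, Set.InjOn (x l) I := by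
    intro l hl i hi k hk hik
    have h1 := hxc l i hl hi
    have h2 := hxc l k hl hk
    have h12 : c l i • v i = c l k • v k := by
      rw [← h1.2.2.1, ← h2.2.2.1, hik]
    refine eq_of_mem_of_mem (hIl i hi).1 (hIl k hk).1 (hIl i hi).2 h1.2.2.2.2 (hIl k hk).2
      (by rw [h12]; exact h2.2.2.2.2) ?_
    intro h0
    exact smul_ne_zero (hc0 l hl i hi) (hv0 i (hIl i hi).1) (left_eq_add.1 h0)
  have hIne : I.Nonempty := Finset.card_pos.1 (by omega)
  refine card_le_of_meetsPencil (I := I) (V := v) (Q := fun l => a l - p) (W := v) (x := x) (c := c)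
    hr hI (fun i hi => (hav i (hIl i hi).1).1) (fun l hl => ?_) (fun l hl l' hl' hne => ?_) ?_
  · refine ⟨(hav l (hMl l hl).1).1, fun i hi => (hxc l i hl hi).2.2.1, hinj l hl,
      fun i hi => (hxc l i hl hi).1, hc0 l hl, fun i hi => ?_, ?_⟩
    · have := (hxc l i hl hi).2.1
      have := (ho i hi).1
      omega
    · obtain ⟨i, hi⟩ := hIne
      have h1 : cross (a l - p) (v l) = cross (c l i • v i) (v l) := by
        rw [← (hxc l i hl hi).2.2.1]
        simp [cross]
        ring
      have h2 : cross (c l i • v i) (v l) = c l i * cross (v i) (v l) := by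
        simp [cross]
        ring
      rw [h1, h2]
      refine mul_ne_zero (hc0 l hl i hi) (hcross i (hIl i hi).1 l (hMl l hl).1 ?_)
      rintro rfl
      exact (hMl i hl).2 (hIl i hi).2
  · refine ⟨hcross l (hMl l hl).1 l' (hMl l' hl').1 hne, ?_, fun i hi => ?_⟩
    · obtain ⟨z, hz, hz'⟩ := hint.exists_mem (hMl l hl).1 (hMl l' hl').1 hne
      obtain ⟨s, hs, hzs⟩ := ((hav l (hMl l hl).1).2 z).1 hz
      obtain ⟨t, ht, hzt⟩ := ((hav l' (hMl l' hl').1).2 z).1 hz'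
      refine ⟨s, t, hs, ht, ?_⟩
      calc a l - p + s • v l = z - p := by rw [hzs]; abel
        _ = a l' - p + t • v l' := by rw [hzt]; abel
    · have := (hxc l i hl hi).2.1
      have := (hxc l' i hl' hi).2.1
      omega
  · intro l hl l' hl' i hi k hk hik hci hck
    have h1 := hxc l i hl hi
    have h2 := hxc l k hl hk
    have h1' := hxc l' i hl' hi
    have h2' := hxc l' k hl' hk
    refine eq_of_mem_of_mem (hMl l hl).1 (hMl l' hl').1 h1.2.2.2.1 h2.2.2.2.1
      (hci ▸ h1'.2.2.2.1) (hck ▸ h2'.2.2.2.1) fun h0 => hik (hinj l hl hi hk ?_)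
    have h3 : x l i • v l = x l k • v l := by
      have := add_left_cancel h0
      rw [← h1.2.2.1, ← h2.2.2.1] at this
      exact add_left_cancel this
    exact smul_left_injective ℤ (hv0 l (hMl l hl).1) h3

end LinearSystem

/-! ### The transversal number -/

theorem mainTheorem6 (S : LinearSystem (ℤ × ℤ)) (r : ℕ)
    (hseg : S.IsSegmentSystem r) (hint : S.IsIntersecting)
    (hr : r = S.twoPackingNumber) (hν : 3 ≤ S.twoPackingNumber)
    (hΔ : ⌊(S.twoPackingNumber : ℚ) / 2⌋₊ + 2 ≤ S.maxDegree) :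
    S.transversalNumber = ⌈(S.twoPackingNumber : ℚ) / 2⌉₊ ∧
      S.transversalNumber ≤ ⌈(r : ℚ) / 2⌉₊ := by
  have hfloor : ⌊(S.twoPackingNumber : ℚ) / 2⌋₊ = S.twoPackingNumber / 2 := by
    exact_mod_cast Nat.floor_div_eq_div (K := ℚ) S.twoPackingNumber 2
  -- This form isolates the one point `p` from the `(r - 1) / 2` points that pierce the lines
  -- missing it.
  have hceil : ⌈(S.twoPackingNumber : ℚ) / 2⌉₊ = (S.twoPackingNumber - 1) / 2 + 1 := by
    rw [Nat.ceil_eq_iff (by omega)]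
    set n := S.twoPackingNumber
    rcases Nat.even_or_odd' n with ⟨k, hk | hk⟩
    · have h1 : (n - 1) / 2 + 1 = k := by omega
      have h2 : k - 1 + 1 = k := by omega
      rw [h1, hk, ← h2]
      push_cast
      constructor <;> simp
    · have h1 : (n - 1) / 2 + 1 = k + 1 := by omega
      rw [h1, hk, Nat.add_sub_cancel]
      push_cast
      constructor <;> linarith
  suffices h : S.transversalNumber = (S.twoPackingNumber - 1) / 2 + 1 by
    rw [← hceil] at h
    exact ⟨h, by rw [hr, h]⟩
  rw [hfloor, ← hr] at hΔ
  rw [← hr] at hν ⊢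
  have hne : ∀ l ∈ S.lines, l.Nonempty := by
    intro l hl
    obtain ⟨a, v, -, rfl⟩ := hseg.consecutive l hl
    exact ⟨_, Finset.mem_image_of_mem _ (Finset.mem_range.2 (show 0 < r by omega))⟩
  obtain ⟨⟨T, hT, hTcard⟩, hmin⟩ := S.isLeast_transversalNumber hne
  obtain ⟨⟨R, hR, hRcard⟩, -⟩ := S.isGreatest_twoPackingNumber
  refine le_antisymm ?_ ?_
  · have hpne : S.points.Nonempty := by
      by_contra h0
      rw [Finset.not_nonempty_iff_eq_empty] at h0
      simp [LinearSystem.maxDegree, h0] at hΔ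
    obtain ⟨p, hp, hpmax⟩ := Finset.exists_mem_eq_sup S.points hpne S.degree
    have hdeg : r / 2 + 2 ≤ S.degree p := by
      rw [← hpmax]
      exact hΔ
    obtain ⟨T', hT'S, hT'card, hT'⟩ := hint.exists_cover hne _ _ (Finset.filter_subset _ _)
      (hseg.card_filter_notMem_le hint hν hdeg)
    have htr : S.IsTransversal (insert p T') := by
      refine ⟨Finset.insert_subset hp hT'S, fun l hl => ?_⟩
      by_cases hpl : p ∈ l
      · exact ⟨p, by simp [hpl]⟩
      · obtain ⟨w, hw⟩ := hT' l (Finset.mem_filter.2 ⟨hl, hpl⟩)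
        rw [Finset.mem_inter] at hw
        exact ⟨w, by simp [hw.1, hw.2]⟩
    have h1 := hmin ⟨_, htr, rfl⟩
    have h2 := Finset.card_insert_le p T'
    omega
  · have h1 := hR.card_le hT
    omega
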